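/- Let $\mathfrak C$ be a monster model: a saturated first-order structure whose cardinality is uncountable and larger than that of its language. "Small" means of cardinality $<|\mathfrak C|$; $A\subset\mathfrak C$ denotes a small set and $M$ a small elementary submodel of $\mathfrak C$ with $A\subseteq M$. Global types are complete $1$-types over $\mathfrak C$; $\mathfrak p_{\restriction B}$ is the restriction of $\mathfrak p$ to $B$, and $\vdash$ between types over small sets is inclusion of their sets of realizations in $\mathfrak C$. Let $\mathfrak p$ be a global $A$-invariant type (it does not split over $A$). * A *Morley sequence* in $\mathfrak p$ over $A$ is a sequence $(a_i\mid i\in I)$ in $\mathfrak C$, indexed by a linear order $I$, with $a_i\models\mathfrak p_{\restriction A a_{<i}}$ for all $i\in I$. The type $\mathfrak p$ is *$A$-asymmetric* if $\mathrm{tp}(a,b/A)\ne\mathrm{tp}(b,a/A)$ for some Morley sequence $(a,b)$ in $\mathfrak p$ over $A$. * A non-algebraic $\mathfrak p$ is *regular over $A$* if for all small $B\supseteq A$ and all $a\models\mathfrak p_{\restriction A}$, either $a\models\mathfrak p_{\restriction B}$ or $\mathfrak p_{\restriction B}\vdash\mathfrak p_{\restriction Ba}$. It is *strongly regular over $A$*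 if there is a formula $\phi(x)$ over $A$ in $\mathfrak p$ such that the same alternative holds for all small $B\supseteq A$ and all $a\in\phi(\mathfrak C)$. * A *witness* of the asymmetry of $\mathfrak p$ over $A$ is an $A$-definable strict partial order $<$ on $\mathfrak C$ such that all Morley sequences in $\mathfrak p$ over $A$ are strictly $<$-increasing. The type $\mathfrak p$ is *convex over $A$* if for some witness $<$ the locus $\mathfrak p_{\restriction A}(\mathfrak C)$ is a $<$-convex subset of $\mathfrak C$. * $\mathcal E_{\mathfrak p}(a)$ is the set of all $b\models\mathfrak p_{\restriction A}$ such that neither $(a,b)$ nor $(b,a)$ is a Morley sequence in $\mathfrak p$ over $A$. The type $\mathfrak p$ is *simple over $A$* if the relation $x\in\mathcal E_{\mathfrak p}(y)$ on $\mathfrak p_{\restriction A}(\mathfrak C)$ is relatively definable over $A$. * $\mathrm{Inv}_{\mathfrak p,A}(M)$ is the order type of any maximal Morley sequence in $\mathfrak p$ over $A$ consisting of elements of $M$ (empty if there are no such elements). * For $A$-invariant $\mathfrak p,\mathfrak q$, $(\mathfrak p\otimes\mathfrak q)(x,y)$ is the type over $\mathfrak C$ of $(a,b)$, where $a\models\mathfrak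 p$ and $b\models\mathfrak q_{\restriction\mathfrak C a}$ in a larger universe; $\mathfrak p\otimes\mathfrak q$ and $\mathfrak q\otimes\mathfrak p$ are compared as types in the same variables $(x,y)$. * $\mathfrak p_{\restriction A}\not\perp^w\mathfrak q_{\restriction A}$ means that $\mathfrak p_{\restriction A}(x)\cup\mathfrak q_{\restriction A}(y)$ does not determine a complete type over $A$. A set $D$ is *$\mathfrak q$-bounded* if it meets $\mathfrak q_{\restriction A}(\mathfrak C)$ and there are a witness $<$ for $\mathfrak q$ and $c,c'\models\mathfrak q_{\restriction A}$ with $c<d<c'$ for all $d\in D\cap\mathfrak q_{\restriction A}(\mathfrak C)$. The non-orthogonality is *bounded* if there are $a\models\mathfrak p_{\restriction A}$, $b\models\mathfrak q_{\restriction A}$ and $\theta(x,y)\in\mathrm{tp}(a,b/A)$ such that $\theta(a,\mathfrak C)$ is $\mathfrak q$-bounded, and *unbounded* otherwise. * $\mathcal D(L)$, the Dedekind completion of a linear order $L$, is the set of all initial segments of $L$ (including $\emptyset$) that have no maximum, ordered by inclusion. In particular $\mathcal D(\emptyset)$ is a one-element order. **Theorem.** Suppose that $\mathfrak p$ and $\mathfrak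 q$ are regular over $A$, convex over $A$ and $A$-asymmetric, and that $\mathfrak p_{\restriction A}\not\perp^w\mathfrak q_{\restriction A}$. (i) Suppose that the non-orthogonality is bounded. Then for every small model $M\supseteq A$ the invariants $\mathrm{Inv}_{\mathfrak p,A}(M)$ and $\mathrm{Inv}_{\mathfrak q,A}(M)$ are well defined, and 1) if $(\mathfrak p\otimes\mathfrak q)_{\restriction A}\neq(\mathfrak q\otimes\mathfrak p)_{\restriction A}$, they are isomorphic; 2) if $(\mathfrak p\otimes\mathfrak q)_{\restriction A}=(\mathfrak q\otimes\mathfrak p)_{\restriction A}$, they are anti-isomorphic. (ii) Suppose that $\mathfrak p$ and $\mathfrak q$ are strongly regular over $A$ and that the non-orthogonality is unbounded. Then $\mathfrak p$ and $\mathfrak q$ are simple over $A$, and for every small model $M\supseteq A$ the invariants are well defined, and 1) if $(\mathfrak p\otimes\mathfrak q)_{\restriction A}\neq(\mathfrak q\otimes\mathfrak p)_{\restriction A}$, the Dedekind completions $\mathcal D(\mathrm{Inv}_{\mathfrak p,A}(M))$ and $\mathcal D(\mathrm{Inv}_{\mathfrak q,A}(M))$ are isomorphic; 2) if $(\mathfrak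 p\otimes\mathfrak q)_{\restriction A}=(\mathfrak q\otimes\mathfrak p)_{\restriction A}$, the Dedekind completions are anti-isomorphic. -/

import Mathlib

open FirstOrder Cardinal

universe u v w

namespace RegularTypes

section Basics

variable (L : FirstOrder.Language.{u, v}) {C : Type w} [L.Structure C]

/-- Formulas with parameters from `B` and free variables indexed by `α`: the parameters are put in
place of the left-hand variables. -/
abbrev FormulaOver (B : Set C) (α : Type) := L.Formula (B ⊕ α)

variable {L}

/-- The tuple `x` of elements of `C` satisfies the formula `φ` with parameters from `B`. -/
def Sat {B : Set C} {α : Type} (φ : FormulaOver L B α) (x : α → C) : Prop :=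
  φ.Realize (Sum.elim (fun b : B => (b : C)) x)

/-- A set is small if its cardinality is less than that of the monster model `C`. -/
def IsSmall (B : Set C) : Prop := #B < #C

variable (L C) in
/-- Saturation of `C`: every set of formulas in one variable over a small set of parameters that
is finitely satisfiable in `C` is realized in `C`. -/
def IsSaturated : Prop :=
  ∀ B : Set C, IsSmall B → ∀ S : Set (FormulaOver L B (Fin 1)),
    (∀ F : Finset (FormulaOver L B (Fin 1)), (F : Set (FormulaOver L B (Fin 1))) ⊆ S →
      ∃ c : C, ∀ φ ∈ F, Sat φ ![c]) →
    ∃ c : C, ∀ φ ∈ S, Sat φ ![c]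

variable (L C) in
/-- `C` is a monster model: an uncountable saturated structure whose cardinality is greater than
the cardinality of the language. -/
structure IsMonster : Prop where
  uncountable : ℵ₀ < #C
  language_small : Cardinal.lift.{w} L.card < Cardinal.lift.{max u v} #C
  saturated : IsSaturated L C

variable (L) in
/-- `tp(x/B)`. -/
def tp (B : Set C) {α : Type} (x : α → C) : Set (FormulaOver L B α) := {φ | Sat φ x}

/-- The set of realizations in `C` of a set of formulas over `B`. -/
def solutions {B : Set C} {α : Type} (S : Set (FormulaOver L B α)) : Set (α → C) :=
  {x | ∀ φ ∈ S, Sat φ x}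

variable (L C) in
/-- Global `1`-types: complete types in one variable over the whole of `C`. -/
abbrev GlobalType := (L.elementaryDiagram C).CompleteType (Fin 1)

/-- The formula `φ(x)` with parameters from `C` belongs to the global type `p`. -/
def Mem (p : GlobalType L C) (φ : L.Formula (C ⊕ Fin 1)) : Prop :=
  FirstOrder.Language.Formula.equivSentence (FirstOrder.Language.BoundedFormula.constantsVarsEquiv.symm φ :
    L[[C]].Formula (Fin 1)) ∈ p

/-- A formula over `B`, seen as a formula over `C`. -/
def toGlobal {B : Set C} {α : Type} (φ : FormulaOver L B α) : L.Formula (C ⊕ α) :=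
  FirstOrder.Language.Formula.relabel (Sum.map (fun b : B => (b : C)) id) φ

/-- The restriction of the global type `p` to `B`. -/
def restrict (p : GlobalType L C) (B : Set C) : Set (FormulaOver L B (Fin 1)) :=
  {φ | Mem p (toGlobal φ)}

/-- The locus of the restriction of `p` to `B`, i.e. the set of elements of `C` realizing it. -/
def locus (p : GlobalType L C) (B : Set C) : Set C :=
  {a | ![a] ∈ solutions (restrict p B)}

/-- `p` is non-algebraic: every formula in it has infinitely many solutions. -/
def IsNonalgebraic (p : GlobalType L C) : Prop :=
  ∀ φ : L.Formula (C ⊕ Fin 1), Mem p φ → {c : C | φ.Realize (Sum.elim id ![c])}.Infinite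

/-- The formula `φ(y, x)` with the parameters `b` substituted for `y`. -/
def substParams {n : ℕ} (φ : L.Formula (Fin n ⊕ Fin 1)) (b : Fin n → C) :
    L.Formula (C ⊕ Fin 1) :=
  φ.relabel (Sum.map b id)

/-- `p` is invariant over `A`, i.e. it does not split over `A`. (Parameters from `A` may be
included in the tuples `b` and `b'`, so it is enough to consider formulas `φ` without them.) -/
def IsInvariant (p : GlobalType L C) (A : Set C) : Prop :=
  ∀ (n : ℕ) (φ : L.Formula (Fin n ⊕ Fin 1)) (b b' : Fin n → C), tp L A b = tp L A b' →
    (Mem p (substParams φ b) ↔ Mem p (substParams φ b'))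

/-- `p` is regular over `A`. -/
structure IsRegularOver (p : GlobalType L C) (A : Set C) : Prop where
  nonalgebraic : IsNonalgebraic p
  invariant : IsInvariant p A
  regular : ∀ B : Set C, A ⊆ B → IsSmall B → ∀ a ∈ locus p A,
    a ∈ locus p B ∨ locus p B ⊆ locus p (B ∪ {a})

/-- `p` is strongly regular over `A`: it is invariant over `A` and for some formula `φ` over `A`
that belongs to `p` the regularity condition holds for all `a` satisfying `φ`. -/
def IsStronglyRegularOver (p : GlobalType L C) (A : Set C) : Prop :=
  IsInvariant p A ∧ ∃ φ ∈ restrict p A, ∀ B : Set C, A ⊆ B → IsSmall B → ∀ a : C, Sat φ ![a] →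
    a ∈ locus p B ∨ locus p B ⊆ locus p (B ∪ {a})

/-- `(a i | i ∈ I)` is a Morley sequence in `p` over `A`. -/
def IsMorley (p : GlobalType L C) (A : Set C) {I : Type*} [LinearOrder I] (a : I → C) : Prop :=
  ∀ i, a i ∈ locus p (A ∪ a '' Set.Iio i)

/-- The pair `(a, b)` is a Morley sequence in `p` over `A`. -/
def IsMorleyPair (p : GlobalType L C) (A : Set C) (a b : C) : Prop :=
  a ∈ locus p A ∧ b ∈ locus p (A ∪ {a})

/-- `p` is `A`-asymmetric. -/
def IsAsymmetric (p : GlobalType L C) (A : Set C) : Prop :=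
  IsInvariant p A ∧ ∃ a b : C, IsMorleyPair p A a b ∧ tp L A ![a, b] ≠ tp L A ![b, a]

/-- The `A`-definable relation `ρ(x, y)` is a strict partial order on `C` which witnesses the
asymmetry of `p` over `A`: Morley sequences in `p` over `A` are strictly increasing. It is enough
to require this of pairs, see `IsWitness.strictly_increasing`. -/
structure IsWitness (p : GlobalType L C) (A : Set C) (ρ : FormulaOver L A (Fin 2)) : Prop where
  irrefl : ∀ a : C, ¬ Sat ρ ![a, a]
  trans : ∀ a b c : C, Sat ρ ![a, b] → Sat ρ ![b, c] → Sat ρ ![a, c]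
  increasing : ∀ a b : C, IsMorleyPair p A a b → Sat ρ ![a, b]

/-- `p` is convex over `A`: for some witnessing order, the locus of the restriction of `p` to `A`
is a convex subset of `C`. -/
def IsConvex (p : GlobalType L C) (A : Set C) : Prop :=
  ∃ ρ : FormulaOver L A (Fin 2), IsWitness p A ρ ∧
    ∀ a ∈ locus p A, ∀ c ∈ locus p A, ∀ b : C, Sat ρ ![a, b] → Sat ρ ![b, c] → b ∈ locus p A

/-- The class `𝓔_p(a)`: the set of those realizations `b` of the restriction of `p` to `A` for
which neither `(a, b)` nor `(b, a)` is a Morley sequence. -/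
def eClass (p : GlobalType L C) (A : Set C) (a : C) : Set C :=
  {b | b ∈ locus p A ∧ b ∉ locus p (A ∪ {a}) ∧ a ∉ locus p (A ∪ {b})}

/-- `p` is simple over `A`: the relation `x ∈ 𝓔_p(y)` is relatively `A`-definable within the locus
of the restriction of `p` to `A`. -/
def IsSimple (p : GlobalType L C) (A : Set C) : Prop :=
  ∃ σ : FormulaOver L A (Fin 2), ∀ a ∈ locus p A, ∀ b ∈ locus p A,
    (Sat σ ![a, b] ↔ a ∈ eClass p A b)

/-- Weak orthogonality of types `P(x)` and `Q(y)` over `A`: their union determines a complete type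
in `(x, y)` over `A`. -/
def WeaklyOrthogonal {A : Set C} (P Q : Set (FormulaOver L A (Fin 1))) : Prop :=
  ∀ a a' b b' : C, ![a] ∈ solutions P → ![a'] ∈ solutions P → ![b] ∈ solutions Q →
    ![b'] ∈ solutions Q → tp L A ![a, b] = tp L A ![a', b']

/-- A subset `D` of `C` is `q`-bounded over `A`. -/
def IsBoundedSet (q : GlobalType L C) (A : Set C) (D : Set C) : Prop :=
  (D ∩ locus q A).Nonempty ∧
    ∃ ρ : FormulaOver L A (Fin 2), IsWitness q A ρ ∧ ∃ c ∈ locus q A, ∃ c' ∈ locus q A,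
      ∀ d ∈ D ∩ locus q A, Sat ρ ![c, d] ∧ Sat ρ ![d, c']

/-- The bounded kind of weak non-orthogonality of the restrictions of `p` and `q` to `A`; the
unbounded kind is its negation. -/
def BoundedKind (p q : GlobalType L C) (A : Set C) : Prop :=
  ∃ a ∈ locus p A, ∃ b ∈ locus q A, ∃ θ ∈ tp L A ![a, b],
    IsBoundedSet q A {y | Sat θ ![a, y]}

/-- The formula `φ(a, y)` obtained from the formula `φ(x, y)` over `B`. -/
def plugLeft {B : Set C} (φ : FormulaOver L B (Fin 2)) (a : C) : L.Formula (C ⊕ Fin 1) :=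
  FirstOrder.Language.Formula.relabel (Sum.elim (fun b : B => Sum.inl (b : C)) ![Sum.inl a, Sum.inr 0]) φ

/-- The product `p(x) ⊗ q(y)` (a set of formulas with parameters from `C`; variable `0` is `x`,
variable `1` is `y`), i.e. the type over `C` of `(a, b)`, where `a` realizes `p` and `b` realizes
the invariant extension of `q` to `C ∪ {a}`. A formula `φ(x, y)` belongs to it iff for some small
`B` which contains its parameters and over which `q` is invariant, `φ(a, y) ∈ q` for the elements
`a` of `C` which realize the restriction of `p` to `B`. -/
def tensor (p q : GlobalType L C) : Set (L.Formula (C ⊕ Fin 2)) :=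
  {φ | ∃ B : Set C, IsSmall B ∧ IsInvariant q B ∧ ∃ ψ : FormulaOver L B (Fin 2),
    φ = toGlobal ψ ∧ ∀ a ∈ locus p B, Mem q (plugLeft ψ a)}

/-- The restriction of `p(x) ⊗ q(y)` to `A`. -/
def tensorRestrict (p q : GlobalType L C) (A : Set C) : Set (FormulaOver L A (Fin 2)) :=
  {φ | toGlobal φ ∈ tensor p q}

/-- The formula `φ(y, x)`. -/
def swapVars {A : Set C} (φ : FormulaOver L A (Fin 2)) : FormulaOver L A (Fin 2) :=
  FirstOrder.Language.Formula.relabel (Sum.map id ![1, 0]) φ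

/-- The restrictions of `p(x) ⊗ q(y)` and `q(y) ⊗ p(x)` to `A` are equal (as types in `(x, y)`). -/
def CommuteOver (p q : GlobalType L C) (A : Set C) : Prop :=
  tensorRestrict p q A = {φ | swapVars φ ∈ tensorRestrict q p A}

/-- `(a i | i ∈ I)` is a maximal Morley sequence in `p` over `A` among those that consist of
elements of `X`: it cannot be properly extended. -/
structure IsMaximalMorley (p : GlobalType L C) (A X : Set C) {I : Type w} [LinearOrder I]
    (a : I → C) : Prop where
  mem : ∀ i, a i ∈ X
  morley : IsMorley p A a
  maximal : ∀ (J : Type w) [LinearOrder J] (b : J → C) (f : I ↪o J),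
    (∀ j, b j ∈ X) → IsMorley p A b → b ∘ f = a → Function.Surjective f

/-- The order type of `I` is the invariant `Inv_{p,A}(X)`: up to isomorphism, `I` is the
one and only order that indexes a maximal Morley sequence in `p` over `A` of elements of `X`. -/
def IsInv (p : GlobalType L C) (A X : Set C) (I : Type w) [LinearOrder I] : Prop :=
  (∃ a : I → C, IsMaximalMorley p A X a) ∧
    ∀ (I' : Type w) [LinearOrder I'] (a' : I' → C), IsMaximalMorley p A X a' → Nonempty (I' ≃o I)

/-- Formulas with the same solutions in `C` belong to the same global types. -/
theorem mem_congr (p : GlobalType L C) {φ ψ : L.Formula (C ⊕ Fin 1)}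
    (h : ∀ x : Fin 1 → C, φ.Realize (Sum.elim id x) ↔ ψ.Realize (Sum.elim id x)) :
    Mem p φ ↔ Mem p ψ := by
  have aux : ∀ φ ψ : L.Formula (C ⊕ Fin 1),
      (∀ x : Fin 1 → C, φ.Realize (Sum.elim id x) ↔ ψ.Realize (Sum.elim id x)) →
      Mem p φ → Mem p ψ := by
    intro φ ψ h hφ
    set φ' : L[[C]].Formula (Fin 1) := FirstOrder.Language.BoundedFormula.constantsVarsEquiv.symm φ
      with hφ'
    set ψ' : L[[C]].Formula (Fin 1) := FirstOrder.Language.BoundedFormula.constantsVarsEquiv.symm ψ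
      with hψ'
    have real : ∀ χ : L.Formula (C ⊕ Fin 1), ∀ x : Fin 1 → C,
        FirstOrder.Language.Formula.Realize (L := L[[C]])
          (FirstOrder.Language.BoundedFormula.constantsVarsEquiv.symm χ) x ↔
          χ.Realize (Sum.elim id x) := by
      intro χ x
      unfold FirstOrder.Language.Formula.Realize
      rw [← FirstOrder.Language.BoundedFormula.realize_constantsVarsEquiv, Equiv.apply_symm_apply]
      rfl
    let s : L[[C]].Sentence :=
      FirstOrder.Language.Formula.iAlls (Fin 1) ((φ'.imp ψ').relabel Sum.inr)
    have hs : s ∈ L.elementaryDiagram C := by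
      change C ⊨ s
      simp only [s, FirstOrder.Language.Sentence.Realize,
        FirstOrder.Language.Formula.realize_iAlls, FirstOrder.Language.Formula.realize_relabel,
        FirstOrder.Language.Formula.realize_imp]
      intro x hx
      exact (real ψ _).2 ((h _).1 ((real φ _).1 hx))
    refine p.isMaximal.mem_of_models ?_
    rw [FirstOrder.Language.Theory.models_sentence_iff]
    intro N
    have hN := FirstOrder.Language.Theory.realize_sentence_of_mem (M := N) _
      (p.subset ⟨s, hs, rfl⟩)
    have hNφ := FirstOrder.Language.Theory.realize_sentence_of_mem (M := N) _ hφ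
    let _ : L[[C]].Structure N := (L[[C]].lhomWithConstants (Fin 1)).reduct N
    have _ := FirstOrder.Language.LHom.isExpansionOn_reduct (L[[C]].lhomWithConstants (Fin 1)) N
    rw [FirstOrder.Language.LHom.realize_onSentence] at hN
    rw [FirstOrder.Language.Formula.realize_equivSentence] at hNφ ⊢
    simp only [s, FirstOrder.Language.Sentence.Realize,
      FirstOrder.Language.Formula.realize_iAlls, FirstOrder.Language.Formula.realize_relabel,
      FirstOrder.Language.Formula.realize_imp] at hN
    exact hN _ hNφ
  exact ⟨aux φ ψ h, aux ψ φ fun x => (h x).symm⟩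

theorem locus_mono (p : GlobalType L C) {B B' : Set C} (hB : B ⊆ B') :
    locus p B' ⊆ locus p B := by
  intro x hx φ hφ
  have key := hx (FirstOrder.Language.Formula.relabel (Sum.map (Set.inclusion hB) id) φ) <| by
    refine (mem_congr p fun y => ?_).1 hφ
    simp only [toGlobal, FirstOrder.Language.Formula.realize_relabel]
    apply iff_of_eq
    congr 1
    ext (b | k) <;> rfl
  simp only [Sat, FirstOrder.Language.Formula.realize_relabel] at key ⊢
  convert key using 1
  ext (b | k) <;> rfl

theorem IsWitness.strictly_increasing {p : GlobalType L C} {A : Set C}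
    {ρ : FormulaOver L A (Fin 2)} (h : IsWitness p A ρ) {I : Type*} [LinearOrder I] {a : I → C}
    (ha : IsMorley p A a) {i j : I} (hij : i < j) : Sat ρ ![a i, a j] :=
  h.increasing _ _ ⟨locus_mono p Set.subset_union_left (ha i),
    locus_mono p (Set.union_subset_union_right A
      (Set.singleton_subset_iff.2 (Set.mem_image_of_mem a (Set.mem_Iio.2 hij)))) (ha j)⟩

end Basics

/-- The Dedekind completion: the set of all initial segments of `I` without maximum, ordered by
inclusion. -/
def DedekindCompletion (I : Type*) [LinearOrder I] : Type _ :=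
  {S : Set I // IsLowerSet S ∧ ∀ m, ¬ IsGreatest S m}

instance (I : Type*) [LinearOrder I] : PartialOrder (DedekindCompletion I) :=
  inferInstanceAs (PartialOrder {S : Set I // IsLowerSet S ∧ ∀ m, ¬ IsGreatest S m})

end RegularTypes

open RegularTypes

/-!
Let `a ◁ b` mean that `(a, b)` is a Morley pair in `p` over `A`, i.e. that `b` realizes the
restriction of `p` to `A ∪ {a}`. A witness of asymmetry makes `◁` asymmetric on the locus of the
restriction of `p` to `A`, and by regularity an element that does not realize the restriction of
`p` to `B` does not affect `p` over `B` (`ConvexRegular.absorb`). Hence `◁` is a strict weak order,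
Morley sequences are the `◁`-increasing ones, maximal ones in a model `M` are the transversals of
the classes of incomparable elements, and `Inv_{p,A}(M)` is the order of those classes that meet `M`
(`ConvexRegular.isInv`).

For non-orthogonal `p` and `q` the basic tool is that an element which does not affect `q` does not
affect `p` either (`NonorthPair.locus_subset_of_locus_subset`). If `p ⊗ q` and `q ⊗ p` differ over
`A`, it makes independence an order on the two loci together. If they are equal, independence of
`a` from `b` is a symmetric relation, which is closed upwards in both arguments.

In the bounded case convexity yields a definable relation `r` that assigns to each `a` a nonempty
bounded set of realizations of `q` dependent on `a` (`NonorthPair.exists_bounded_relation`). All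
of them lie in the one class that corresponds to the class of `a`: the class incomparable with `a`
(`match_of_bounded`) or, for equal products, the last class that is dependent on `a`
(`coMatch_of_bounded`). As `r` is definable, corresponding classes meet the same models.

In the unbounded case dependence of `b` on `a` is relatively definable
(`NonorthPair.exists_def2_iff`). Elements `a ◁ a'` are separated by realizations of `q`. By strong
regularity of `q`, the separating elements need only be sought among the solutions of a formula:
solutions outside the locus of `q` affect neither `q` nor `p`, so they separate nothing
(`NonorthPair.exists_separating`). This makes `◁` relatively definable, so that `p` is simple, and
it places separating elements in every model `M ∋ a, a'`. So the two invariants lie interleaved in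
a common linear order, the second one possibly reversed, and their Dedekind completions are
isomorphic or anti-isomorphic. In the reversed case, it is used that by convexity the invariants are
dense (`NonorthPair.exists_between_mem_same`).
-/

namespace RegularTypes

/-! ### Definable relations, types and loci -/

section Semantics

variable {L : FirstOrder.Language.{u, v}} {C : Type w} [L.Structure C]

theorem mem_not (p : GlobalType L C) (φ : L.Formula (C ⊕ Fin 1)) :
    Mem p φ.not ↔ ¬ Mem p φ :=
  p.not_mem_iff _

theorem mem_inf (p : GlobalType L C) (φ ψ : L.Formula (C ⊕ Fin 1)) :
    Mem p (φ ⊓ ψ) ↔ Mem p φ ∧ Mem p ψ := by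
  have := FirstOrder.Language.Theory.CompleteType.typesWith_inf (T := L.elementaryDiagram C)
    (FirstOrder.Language.Formula.equivSentence
      (FirstOrder.Language.BoundedFormula.constantsVarsEquiv.symm φ : L[[C]].Formula (Fin 1)))
    (FirstOrder.Language.Formula.equivSentence
      (FirstOrder.Language.BoundedFormula.constantsVarsEquiv.symm ψ : L[[C]].Formula (Fin 1)))
  exact Set.ext_iff.1 this p

theorem exists_realize_of_mem {p : GlobalType L C} {φ : L.Formula (C ⊕ Fin 1)} (h : Mem p φ) :
    ∃ c : C, φ.Realize (Sum.elim id ![c]) := by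
  by_contra! hc
  have hc' : ∀ x : Fin 1 → C, ¬ φ.Realize (Sum.elim id x) := fun x hx => by
    refine hc (x 0) ?_
    convert hx using 2
    ext i
    fin_cases i
    rfl
  have : Mem p (φ ⊓ φ.not) := (mem_congr p fun x => by
    simp only [FirstOrder.Language.Formula.realize_inf, hc' x, false_and]).1 h
  exact (mem_not p φ).1 ((mem_inf p _ _).1 this).2 h

/-- The global type `p` contains a formula that defines `s`; informally, `s` holds of a
realization of `p` in a larger universe. -/
def Holds (p : GlobalType L C) (s : C → Prop) : Prop :=
  ∃ φ : L.Formula (C ⊕ Fin 1), Mem p φ ∧ ∀ x, φ.Realize (Sum.elim id ![x]) ↔ s x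

variable (L) in
/-- The unary relation `s` is definable with parameters from `B`. -/
def Def1 (B : Set C) (s : C → Prop) : Prop :=
  ∃ φ : FormulaOver L B (Fin 1), ∀ x, Sat φ ![x] ↔ s x

variable (L) in
/-- The binary relation `r` is definable with parameters from `B`. -/
def Def2 (B : Set C) (r : C → C → Prop) : Prop :=
  ∃ φ : FormulaOver L B (Fin 2), ∀ x y, Sat φ ![x, y] ↔ r x y

theorem eta1 {X : Type*} (v : Fin 1 → X) : ![v 0] = v := by
  ext i; fin_cases i; rfl

theorem eta2 {X : Type*} (v : Fin 2 → X) : ![v 0, v 1] = v := by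
  ext i; fin_cases i <;> rfl

theorem definable_iff_sat {B : Set C} {α : Type} {s : Set (α → C)} :
    B.Definable L s ↔ ∃ φ : FormulaOver L B α, ∀ x, Sat φ x ↔ x ∈ s := by
  rw [Set.definable_iff_exists_formula_sum]
  refine exists_congr fun φ => ?_
  rw [Set.ext_iff]
  exact forall_congr' fun x => Iff.comm

theorem def1_iff {B : Set C} {s : C → Prop} :
    Def1 L B s ↔ B.Definable L {v : Fin 1 → C | s (v 0)} := by
  rw [definable_iff_sat]
  refine exists_congr fun φ => ⟨fun h x => ?_, fun h x => h ![x]⟩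
  rw [← eta1 x]; exact h (x 0)

theorem def2_iff {B : Set C} {r : C → C → Prop} :
    Def2 L B r ↔ B.Definable L {v : Fin 2 → C | r (v 0) (v 1)} := by
  rw [definable_iff_sat]
  refine exists_congr fun φ => ⟨fun h x => ?_, fun h x y => h ![x, y]⟩
  rw [← eta2 x]; exact h (x 0) (x 1)

theorem Def1.mono {B B' : Set C} (h : B ⊆ B') {s : C → Prop} (hs : Def1 L B s) : Def1 L B' s :=
  def1_iff.2 ((def1_iff.1 hs).mono h)

theorem Def2.mono {B B' : Set C} (h : B ⊆ B') {r : C → C → Prop} (hr : Def2 L B r) :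
    Def2 L B' r :=
  def2_iff.2 ((def2_iff.1 hr).mono h)

theorem Def1.not {B : Set C} {s : C → Prop} (hs : Def1 L B s) : Def1 L B fun x => ¬ s x :=
  def1_iff.2 (def1_iff.1 hs).compl

theorem Def1.and {B : Set C} {s t : C → Prop} (hs : Def1 L B s) (ht : Def1 L B t) :
    Def1 L B fun x => s x ∧ t x :=
  def1_iff.2 ((def1_iff.1 hs).inter (def1_iff.1 ht))

theorem Def2.not {B : Set C} {r : C → C → Prop} (hr : Def2 L B r) :
    Def2 L B fun x y => ¬ r x y :=
  def2_iff.2 (def2_iff.1 hr).compl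

theorem Def2.and {B : Set C} {r t : C → C → Prop} (hr : Def2 L B r) (ht : Def2 L B t) :
    Def2 L B fun x y => r x y ∧ t x y :=
  def2_iff.2 ((def2_iff.1 hr).inter (def2_iff.1 ht))

theorem Def2.swap {B : Set C} {r : C → C → Prop} (hr : Def2 L B r) :
    Def2 L B fun x y => r y x :=
  def2_iff.2 ((def2_iff.1 hr).preimage_comp (![1, 0] : Fin 2 → Fin 2))

theorem Def1.left {B : Set C} {s : C → Prop} (hs : Def1 L B s) : Def2 L B fun x _ => s x :=
  def2_iff.2 ((def1_iff.1 hs).preimage_comp (![0] : Fin 1 → Fin 2))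

theorem Def1.right {B : Set C} {s : C → Prop} (hs : Def1 L B s) : Def2 L B fun _ x => s x :=
  hs.left.swap

/-- Definability of `∃ z, r x z ∧ t y z`. -/
theorem Def2.exists_and {B : Set C} {r t : C → C → Prop} (hr : Def2 L B r) (ht : Def2 L B t) :
    Def2 L B fun x y => ∃ z, r x z ∧ t y z := by
  have h3 : B.Definable L {v : Fin 3 → C | r (v 0) (v 2) ∧ t (v 1) (v 2)} :=
    ((def2_iff.1 hr).preimage_comp (![0, 2] : Fin 2 → Fin 3)).inter
      ((def2_iff.1 ht).preimage_comp (![1, 2] : Fin 2 → Fin 3))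
  refine def2_iff.2 ((congr rfl ?_).mp (h3.image_comp (![0, 1] : Fin 2 → Fin 3)))
  ext v
  constructor
  · rintro ⟨g, hg, rfl⟩
    exact ⟨g 2, hg⟩
  · rintro ⟨z, hz⟩
    refine ⟨![v 0, v 1, z], hz, ?_⟩
    ext i; fin_cases i <;> rfl

theorem Def2.fiber {B : Set C} {r : C → C → Prop} (hr : Def2 L B r) (a : C) :
    Def1 L (B ∪ {a}) (r a) := by
  obtain ⟨φ, hφ⟩ := hr
  refine ⟨FirstOrder.Language.Formula.relabel
    (Sum.elim (fun b : B => Sum.inl (⟨b, Or.inl b.2⟩ : (B ∪ {a} : Set C)))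
      ![Sum.inl ⟨a, Or.inr rfl⟩, Sum.inr 0]) φ,
    fun x => ?_⟩
  rw [← hφ]
  simp only [Sat, FirstOrder.Language.Formula.realize_relabel]
  apply iff_of_eq
  congr 1
  ext (b | i)
  · rfl
  · fin_cases i <;> rfl

theorem Def1.exists_fiber {B : Set C} {s : C → Prop} {a : C} (hs : Def1 L (B ∪ {a}) s) :
    ∃ r, Def2 L B r ∧ ∀ x, r a x ↔ s x := by
  classical
  obtain ⟨φ, hφ⟩ := hs
  let ψ : FormulaOver L B (Fin 2) := FirstOrder.Language.Formula.relabel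
    (Sum.elim (fun d : (B ∪ {a} : Set C) => if h : (d : C) ∈ B then Sum.inl ⟨d, h⟩ else Sum.inr 0)
      (fun _ => Sum.inr 1)) φ
  refine ⟨fun x y => Sat ψ ![x, y], ⟨ψ, fun x y => Iff.rfl⟩, fun x => ?_⟩
  rw [← hφ]
  simp only [ψ, Sat, FirstOrder.Language.Formula.realize_relabel]
  apply iff_of_eq
  congr 1
  ext (⟨d, hd⟩ | i)
  · by_cases h : d ∈ B
    · simp [h]
    · obtain rfl : d = a := by simpa [h] using hd
      simp [h]
  · simp

theorem Def2.exists {B : Set C} {r : C → C → Prop} (hr : Def2 L B r) :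
    Def1 L B fun x => ∃ y, r x y := by
  refine def1_iff.2 ((congr rfl ?_).mp ((def2_iff.1 hr).image_comp (![0] : Fin 1 → Fin 2)))
  ext v
  constructor
  · rintro ⟨g, hg, rfl⟩
    exact ⟨g 1, hg⟩
  · rintro ⟨z, hz⟩
    refine ⟨![v 0, z], hz, ?_⟩
    ext i; fin_cases i; rfl

theorem tp_eq_iff {B : Set C} {α : Type} {x y : α → C} :
    tp L B x = tp L B y ↔ ∀ s, B.Definable L s → (x ∈ s → y ∈ s) := by
  constructor
  · intro h s hs hx
    obtain ⟨φ, hφ⟩ := definable_iff_sat.1 hs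
    exact (hφ y).1 (h ▸ (hφ x).2 hx : φ ∈ tp L B y)
  · intro h
    ext φ
    have hd : B.Definable L {x | Sat φ x} := definable_iff_sat.2 ⟨φ, fun _ => Iff.rfl⟩
    exact ⟨fun hx => h _ hd hx, fun hy => by
      by_contra hx
      exact h _ hd.compl hx hy⟩

theorem tp1_eq_iff {B : Set C} {a b : C} :
    tp L B ![a] = tp L B ![b] ↔ ∀ s, Def1 L B s → s a → s b := by
  rw [tp_eq_iff]
  refine ⟨fun h s hs => h _ (def1_iff.1 hs), fun h s hs => h (fun x => ![x] ∈ s) ?_⟩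
  refine def1_iff.2 ?_
  convert hs using 1
  ext v
  exact iff_of_eq (congrArg (· ∈ s) (eta1 v))

theorem tp2_eq_iff {B : Set C} {a b a' b' : C} :
    tp L B ![a, b] = tp L B ![a', b'] ↔ ∀ r, Def2 L B r → r a b → r a' b' := by
  rw [tp_eq_iff]
  refine ⟨fun h s hs => h _ (def2_iff.1 hs), fun h s hs => h (fun x y => ![x, y] ∈ s) ?_⟩
  refine def2_iff.2 ?_
  convert hs using 1
  ext v
  exact iff_of_eq (congrArg (· ∈ s) (eta2 v))

theorem tp1_mono {B B' : Set C} (hB : B ⊆ B') {a b : C} (h : tp L B' ![a] = tp L B' ![b]) :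
    tp L B ![a] = tp L B ![b] :=
  tp1_eq_iff.2 fun s hs => tp1_eq_iff.1 h s (hs.mono hB)

theorem tp2_mono {B B' : Set C} (hB : B ⊆ B') {a b a' b' : C}
    (h : tp L B' ![a, b] = tp L B' ![a', b']) : tp L B ![a, b] = tp L B ![a', b'] :=
  tp2_eq_iff.2 fun s hs => tp2_eq_iff.1 h s (hs.mono hB)

theorem tp2_left {B : Set C} {a b a' b' : C} (h : tp L B ![a, b] = tp L B ![a', b']) :
    tp L B ![a] = tp L B ![a'] :=
  tp1_eq_iff.2 fun s hs => tp2_eq_iff.1 h (fun x _ => s x) hs.left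

theorem tp2_swap {B : Set C} {a b a' b' : C} (h : tp L B ![a, b] = tp L B ![a', b']) :
    tp L B ![b, a] = tp L B ![b', a'] :=
  tp2_eq_iff.2 fun r hr => tp2_eq_iff.1 h (fun x y => r y x) hr.swap

theorem tp2_right {B : Set C} {a b a' b' : C} (h : tp L B ![a, b] = tp L B ![a', b']) :
    tp L B ![b] = tp L B ![b'] :=
  tp2_left (tp2_swap h)

theorem tp2_same_left {B : Set C} {a b b' : C} :
    tp L B ![a, b] = tp L B ![a, b'] ↔ tp L (B ∪ {a}) ![b] = tp L (B ∪ {a}) ![b'] := by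
  rw [tp1_eq_iff, tp2_eq_iff]
  constructor
  · intro h s hs hb
    obtain ⟨r, hr, hrs⟩ := hs.exists_fiber
    exact (hrs _).1 (h r hr ((hrs _).2 hb))
  · intro h r hr
    exact h _ (hr.fiber a)

section Holds

variable {p : GlobalType L C} {s t : C → Prop}

theorem mem_iff_holds {φ : L.Formula (C ⊕ Fin 1)} (h : ∀ x, φ.Realize (Sum.elim id ![x]) ↔ s x) :
    Mem p φ ↔ Holds p s := by
  refine ⟨fun hφ => ⟨φ, hφ, h⟩, ?_⟩
  rintro ⟨ψ, hψ, hs⟩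
  refine (mem_congr p fun x => ?_).1 hψ
  rw [← eta1 x, h, hs]

theorem Holds.exists (h : Holds p s) : ∃ x, s x := by
  obtain ⟨φ, hφ, hs⟩ := h
  obtain ⟨c, hc⟩ := exists_realize_of_mem hφ
  exact ⟨c, (hs c).1 hc⟩

theorem Holds.and (hs : Holds p s) (ht : Holds p t) :
    Holds p fun x => s x ∧ t x := by
  obtain ⟨φ, hφ, hs⟩ := hs
  obtain ⟨ψ, hψ, ht⟩ := ht
  refine ⟨φ ⊓ ψ, (mem_inf p _ _).2 ⟨hφ, hψ⟩, fun x => ?_⟩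
  rw [FirstOrder.Language.Formula.realize_inf, hs, ht]

theorem realize_toGlobal {B : Set C} {α : Type} (φ : FormulaOver L B α) (x : α → C) :
    (toGlobal φ).Realize (Sum.elim id x) ↔ Sat φ x := by
  simp only [toGlobal, Sat, FirstOrder.Language.Formula.realize_relabel]
  apply iff_of_eq
  congr 1
  ext (b | k) <;> rfl

theorem Def1.holds_not_iff {B : Set C} (hs : Def1 L B s) :
    Holds p (fun x => ¬ s x) ↔ ¬ Holds p s := by
  obtain ⟨φ, hφ⟩ := hs
  rw [← mem_iff_holds (φ := toGlobal φ) fun x => (realize_toGlobal φ ![x]).trans (hφ x),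
    ← mem_iff_holds (φ := (toGlobal φ).not) fun x => ?_, mem_not]
  rw [FirstOrder.Language.Formula.realize_not, realize_toGlobal, hφ]

theorem mem_restrict_iff {B : Set C} {φ : FormulaOver L B (Fin 1)} :
    φ ∈ restrict p B ↔ Holds p fun x => Sat φ ![x] :=
  mem_iff_holds fun x => realize_toGlobal φ ![x]

theorem mem_locus_iff {B : Set C} {a : C} :
    a ∈ locus p B ↔ ∀ s, Def1 L B s → Holds p s → s a := by
  constructor
  · rintro h s ⟨φ, hφ⟩ hs
    refine (hφ a).1 (h φ (mem_restrict_iff.2 ?_))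
    simpa only [hφ] using hs
  · intro h φ hφ
    exact h _ ⟨φ, fun _ => Iff.rfl⟩ (mem_restrict_iff.1 hφ)

theorem Def1.holds_iff {B : Set C} {a : C} (hs : Def1 L B s) (ha : a ∈ locus p B) :
    Holds p s ↔ s a := by
  refine ⟨mem_locus_iff.1 ha s hs, fun h => ?_⟩
  by_contra hn
  exact mem_locus_iff.1 ha _ hs.not (hs.holds_not_iff.2 hn) h

theorem tp1_eq_of_mem_locus {B : Set C} {a b : C} (ha : a ∈ locus p B) (hb : b ∈ locus p B) :
    tp L B ![a] = tp L B ![b] :=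
  tp1_eq_iff.2 fun _ hs h => (hs.holds_iff hb).1 ((hs.holds_iff ha).2 h)

theorem mem_locus_of_tp1_eq {B : Set C} {a b : C} (h : tp L B ![a] = tp L B ![b])
    (ha : a ∈ locus p B) : b ∈ locus p B :=
  mem_locus_iff.2 fun s hs hp => tp1_eq_iff.1 h s hs (mem_locus_iff.1 ha s hs hp)

end Holds

end Semantics

/-! ### Saturation and invariance -/

section Saturation

variable {L : FirstOrder.Language.{u, v}} {C : Type w} [L.Structure C]

theorem IsMonster.small_insert (hC : IsMonster L C) {B : Set C} (hB : IsSmall B) (a : C) :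
    IsSmall (B ∪ {a}) := by
  refine (mk_union_le _ _).trans_lt (add_lt_of_lt hC.uncountable.le hB ?_)
  rw [mk_singleton]
  exact one_lt_aleph0.trans hC.uncountable

theorem def1_true (B : Set C) : Def1 L B fun _ => True :=
  def1_iff.2 Set.definable_univ

theorem holds_true (p : GlobalType L C) : Holds p fun _ => True := by
  by_contra h
  obtain ⟨x, hx⟩ := ((def1_true ∅).holds_not_iff.2 h).exists
  exact hx trivial

/-- Saturation, for a family of definable sets which is closed under finite intersections. -/
theorem IsMonster.exists_forall (hC : IsMonster L C) {B : Set C} (hB : IsSmall B)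
    {S : Set (C → Prop)} (hd : ∀ s ∈ S, Def1 L B s) (hne : S.Nonempty)
    (hand : ∀ s ∈ S, ∀ t ∈ S, (fun x => s x ∧ t x) ∈ S) (hex : ∀ s ∈ S, ∃ x, s x) :
    ∃ c, ∀ s ∈ S, s c := by
  classical
  obtain ⟨c, hc⟩ := hC.saturated B hB {φ | (fun x => Sat φ ![x]) ∈ S} (by
    intro F hF
    suffices h : ∃ t ∈ S, ∀ c, t c → ∀ φ ∈ F, Sat φ ![c] by
      obtain ⟨t, ht, h⟩ := h
      obtain ⟨c, hc⟩ := hex t ht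
      exact ⟨c, h c hc⟩
    induction F using Finset.induction_on with
    | empty =>
      obtain ⟨t, ht⟩ := hne
      exact ⟨t, ht, by simp⟩
    | insert φ F _ ih =>
      rw [Finset.coe_insert, Set.insert_subset_iff] at hF
      obtain ⟨t, ht, h⟩ := ih hF.2
      refine ⟨_, hand _ hF.1 t ht, fun c hc ψ hψ => ?_⟩
      rcases Finset.mem_insert.1 hψ with rfl | hψ
      · exact hc.1
      · exact h c hc.2 ψ hψ)
  refine ⟨c, fun s hs => ?_⟩
  obtain ⟨φ, hφ⟩ := hd s hs
  refine (hφ c).1 (hc φ ?_)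
  have : (fun x => Sat φ ![x]) = s := funext fun x => propext (hφ x)
  rwa [Set.mem_ofPred_eq, this]

/-- Compactness: a definable set that is disjoint from the locus of the restriction of `p` to a
small set is already disjoint from the set of solutions of some formula in that restriction. -/
theorem IsMonster.exists_holds_disjoint (hC : IsMonster L C) {B B' : Set C} (hB' : IsSmall B')
    (hBB' : B ⊆ B') {p : GlobalType L C} {s : C → Prop} (hs : Def1 L B' s)
    (h : ∀ x ∈ locus p B, ¬ s x) :
    ∃ t, Def1 L B t ∧ Holds p t ∧ ∀ x, t x → ¬ s x := by
  by_contra! hcon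
  obtain ⟨c, hc⟩ := hC.exists_forall hB'
    (S := {u | ∃ t, Def1 L B t ∧ Holds p t ∧ u = fun x => t x ∧ s x})
    (by rintro _ ⟨t, ht, -, rfl⟩; exact (ht.mono hBB').and hs)
    ⟨_, _, def1_true B, holds_true p, rfl⟩
    (by
      rintro _ ⟨t, ht, hpt, rfl⟩ _ ⟨t', ht', hpt', rfl⟩
      refine ⟨_, ht.and ht', hpt.and hpt', funext fun x => propext ?_⟩
      tauto)
    (by
      rintro _ ⟨t, ht, hpt, rfl⟩
      exact hcon t ht hpt)
  exact h c (mem_locus_iff.2 fun t ht hpt => (hc _ ⟨t, ht, hpt, rfl⟩).1)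
    (hc _ ⟨_, def1_true B, holds_true p, rfl⟩).2

theorem IsMonster.locus_nonempty (hC : IsMonster L C) {B : Set C} (hB : IsSmall B)
    (p : GlobalType L C) : (locus p B).Nonempty := by
  by_contra hne
  rw [Set.not_nonempty_iff_eq_empty] at hne
  obtain ⟨t, -, hpt, h⟩ := hC.exists_holds_disjoint hB subset_rfl (p := p) (def1_true B)
    (by simp [hne])
  obtain ⟨x, hx⟩ := hpt.exists
  exact h x hx trivial

/-- Homogeneity of the monster model. -/
theorem IsMonster.exists_tp2_eq (hC : IsMonster L C) {B : Set C} (hB : IsSmall B) {a a' : C}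
    (h : tp L B ![a] = tp L B ![a']) (c : C) :
    ∃ c', tp L B ![a, c] = tp L B ![a', c'] := by
  obtain ⟨c', hc'⟩ := hC.exists_forall (hC.small_insert hB a')
    (S := {s | ∃ r, Def2 L B r ∧ r a c ∧ s = r a'})
    (by rintro _ ⟨r, hr, -, rfl⟩; exact hr.fiber a')
    ⟨_, _, (def1_true B).left, trivial, rfl⟩
    (by
      rintro _ ⟨r, hr, hac, rfl⟩ _ ⟨r', hr', hac', rfl⟩
      exact ⟨_, hr.and hr', ⟨hac, hac'⟩, rfl⟩)
    (by
      rintro _ ⟨r, hr, hac, rfl⟩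
      exact tp1_eq_iff.1 h _ hr.exists ⟨c, hac⟩)
  exact ⟨c', tp2_eq_iff.2 fun r hr hac => hc' _ ⟨r, hr, hac, rfl⟩⟩

/-- The same with the known coordinates on the right. -/
theorem IsMonster.exists_tp2_eq' (hC : IsMonster L C) {B : Set C} (hB : IsSmall B) {a a' : C}
    (h : tp L B ![a] = tp L B ![a']) (c : C) :
    ∃ c', tp L B ![c, a] = tp L B ![c', a'] := by
  obtain ⟨c', hc'⟩ := hC.exists_tp2_eq hB h c
  exact ⟨c', tp2_swap hc'⟩

theorem mem_locus_of_finite {p : GlobalType L C} {B : Set C} {a : C}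
    (h : ∀ F : Finset C, (F : Set C) ⊆ B → a ∈ locus p F) : a ∈ locus p B := by
  refine mem_locus_iff.2 fun s hs hps => ?_
  obtain ⟨F, hF, hd⟩ := Set.definable_iff_finitely_definable.1 (def1_iff.1 hs)
  exact mem_locus_iff.1 (h F hF) s (def1_iff.2 hd) hps

/-- A nonempty set which is definable with parameters from an elementary substructure has an
element in this substructure. -/
theorem Def1.exists_mem {M : L.ElementarySubstructure C} {B : Set C} (hB : B ⊆ (M : Set C))
    {s : C → Prop} (hs : Def1 L B s) (h : ∃ x, s x) : ∃ x ∈ M, s x := by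
  obtain ⟨x, hx, hxM⟩ := M.meetsDefinable {x | s x} h ((def1_iff.1 hs).mono hB)
  exact ⟨x, hxM, hx⟩

end Saturation

section Invariance

variable {L : FirstOrder.Language.{u, v}} {C : Type w} [L.Structure C]
  {p : GlobalType L C} {A : Set C}

theorem IsInvariant.holds (hp : IsInvariant p A) {b b' : C} (h : tp L A ![b] = tp L A ![b'])
    {r : C → C → Prop} (hr : Def2 L A r) (hb : Holds p (r b)) : Holds p (r b') := by
  classical
  obtain ⟨F, hF, hd⟩ := Set.definable_iff_finitely_definable.1 (def2_iff.1 hr)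
  obtain ⟨ψ, hψ⟩ := def2_iff.2 hd
  let e := F.equivFin
  let c : Fin F.card → C := fun i => (e.symm i : C)
  -- The parameters of `ψ` are put into the tuple, following the first variable.
  let φ : L.Formula (Fin (F.card + 1) ⊕ Fin 1) := FirstOrder.Language.Formula.relabel
    (Sum.elim (fun a : (F : Set C) => Sum.inl (e a).succ) ![Sum.inl 0, Sum.inr 0]) ψ
  have key : ∀ y, Mem p (substParams φ (Fin.cons y c)) ↔ Holds p (r y) := by
    intro y
    refine mem_iff_holds fun x => ?_
    rw [← hψ]
    simp only [φ, substParams, Sat, FirstOrder.Language.Formula.realize_relabel]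
    apply iff_of_eq
    congr 1
    ext (a | i)
    · simp [c]
    · fin_cases i <;> rfl
  rw [← key] at hb ⊢
  refine (hp _ φ _ _ ?_).1 hb
  ext χ
  let χ' : FormulaOver L A (Fin 1) := FirstOrder.Language.Formula.relabel
    (Sum.elim Sum.inl (Fin.cons (Sum.inr 0)
      (fun i => Sum.inl ⟨c i, hF (e.symm i).2⟩) : Fin (F.card + 1) → A ⊕ Fin 1)) χ
  have hχ : ∀ y, Sat χ (Fin.cons y c : Fin (F.card + 1) → C) ↔ χ' ∈ tp L A ![y] := by
    intro y
    simp only [χ', tp, Sat, Set.mem_ofPred_eq, FirstOrder.Language.Formula.realize_relabel]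
    apply iff_of_eq
    congr 1
    ext (a | i)
    · rfl
    · refine Fin.cases ?_ (fun i => ?_) i <;> simp
  exact (hχ b).trans ((by rw [h]) : _ ↔ _) |>.trans (hχ b').symm

theorem IsInvariant.mono (hp : IsInvariant p A) {B : Set C} (h : A ⊆ B) : IsInvariant p B := by
  intro n φ b b' hb
  refine hp n φ b b' ?_
  rw [tp_eq_iff] at hb ⊢
  exact fun s hs => hb s (hs.mono h)

theorem IsInvariant.mem_locus (hp : IsInvariant p A) {B : Set C} (hAB : A ⊆ B) {a b a' b' : C}
    (h : tp L B ![a, b] = tp L B ![a', b']) (hb : b ∈ locus p (B ∪ {a})) :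
    b' ∈ locus p (B ∪ {a'}) := by
  refine mem_locus_iff.2 fun s hs hps => ?_
  obtain ⟨r, hr, hrs⟩ := hs.exists_fiber
  obtain rfl : r a' = s := funext fun x => propext (hrs x)
  exact tp2_eq_iff.1 h r hr (mem_locus_iff.1 hb _ (hr.fiber a)
    ((hp.mono hAB).holds (tp2_left h).symm hr hps))

theorem IsInvariant.tp2_eq (hp : IsInvariant p A) {B : Set C} (hAB : A ⊆ B) {a b a' b' : C}
    (h : tp L B ![a] = tp L B ![a']) (hb : b ∈ locus p (B ∪ {a}))
    (hb' : b' ∈ locus p (B ∪ {a'})) : tp L B ![a, b] = tp L B ![a', b'] :=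
  tp2_eq_iff.2 fun _ hr hab => ((hr.fiber a').holds_iff hb').1
    ((hp.mono hAB).holds h hr (((hr.fiber a).holds_iff hb).2 hab))

end Invariance

/-! ### Linear orders obtained from strict weak orders -/

/-- The quotient of a strict weak order by incomparability is a linear order. -/
theorem exists_linearOrder_quotient {X : Type w} (lt : X → X → Prop)
    (hasymm : ∀ x y, lt x y → ¬ lt y x) (hneg : ∀ x y z, lt x y → lt x z ∨ lt z y) :
    ∃ (I : Type w) (_ : LinearOrder I) (π : X → I),
      Function.Surjective π ∧ ∀ x y, π x < π y ↔ lt x y := by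
  classical
  let P : Preorder X :=
    { le := fun x y => ¬ lt y x
      lt := lt
      le_refl := fun x hx => hasymm x x hx hx
      le_trans := fun x y z hxy hyz hzx => (hneg z x y hzx).elim hyz hxy
      lt_iff_le_not_ge := fun x y =>
        ⟨fun h => ⟨hasymm x y h, not_not.2 h⟩, fun h => not_not.1 h.2⟩ }
  have : @Std.Total X (· ≤ ·) :=
    ⟨fun x y => by
      by_contra! h
      exact hasymm y x (not_not.1 h.1) (not_not.1 h.2)⟩
  exact ⟨Antisymmetrization X (· ≤ ·), inferInstance, toAntisymmetrization (· ≤ ·),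
    Quotient.mk_surjective, fun x y => toAntisymmetrization_lt_toAntisymmetrization_iff⟩

/-! ### The order of a single type -/

section Single

variable {L : FirstOrder.Language.{u, v}} {C : Type w} [L.Structure C]
  {p : GlobalType L C} {A : Set C}

/-- The standing hypotheses on a type `p` over a small subset `A` of the monster model. Convexity
provides a witness of asymmetry, so asymmetry is not listed. -/
structure ConvexRegular (p : GlobalType L C) (A : Set C) : Prop where
  monster : IsMonster L C
  small : IsSmall A
  regular : IsRegularOver p A
  convex : IsConvex p A

namespace ConvexRegular

variable (h : ConvexRegular p A)
include h

theorem invariant : IsInvariant p A := h.regular.invariant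

theorem small₁ (a : C) : IsSmall (A ∪ {a}) := h.monster.small_insert h.small a

theorem small₂ (a b : C) : IsSmall (A ∪ {a} ∪ {b}) := h.monster.small_insert (h.small₁ a) b

theorem exists_witness : ∃ lt : C → C → Prop, Def2 L A lt ∧ (∀ a, ¬ lt a a) ∧
    (∀ a b c, lt a b → lt b c → lt a c) ∧
    (∀ a ∈ locus p A, ∀ b ∈ locus p (A ∪ {a}), lt a b) ∧
    ∀ a ∈ locus p A, ∀ c ∈ locus p A, ∀ b, lt a b → lt b c → b ∈ locus p A := by
  obtain ⟨ρ, hρ, hconv⟩ := h.convex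
  exact ⟨fun x y => Sat ρ ![x, y], ⟨ρ, fun _ _ => Iff.rfl⟩, hρ.irrefl, hρ.trans,
    fun a ha b hb => hρ.increasing a b ⟨ha, hb⟩, hconv⟩

theorem asymm {a b : C} (hab : b ∈ locus p (A ∪ {a})) (hba : a ∈ locus p (A ∪ {b})) : False := by
  obtain ⟨lt, -, hirr, htr, hlt, -⟩ := h.exists_witness
  have ha := locus_mono p Set.subset_union_left hba
  have hb := locus_mono p Set.subset_union_left hab
  exact hirr a (htr _ _ _ (hlt a ha b hab) (hlt b hb a hba))

theorem absorb {B : Set C} (hAB : A ⊆ B) (hB : IsSmall B) {a b : C} (ha : a ∈ locus p A)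
    (haB : a ∉ locus p B) (hb : b ∈ locus p B) : b ∈ locus p (B ∪ {a}) :=
  (h.regular.regular B hAB hB a ha).resolve_left haB hb

/-- The realizations in the locus over `A` of the restriction of `p` to `B` form a final segment. -/
theorem mem_locus_of_not {B : Set C} (hAB : A ⊆ B) (hB : IsSmall B) {a b : C} (ha : a ∈ locus p A)
    (hb : b ∈ locus p B) (hab : b ∉ locus p (A ∪ {a})) : a ∈ locus p B := by
  by_contra haB
  exact hab (locus_mono p (Set.union_subset_union_left _ hAB) (h.absorb hAB hB ha haB hb))

theorem mem_locus_of_lt {B : Set C} (hAB : A ⊆ B) (hB : IsSmall B) {a b : C}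
    (hb : b ∈ locus p B) (hab : a ∈ locus p (A ∪ {b})) : a ∈ locus p B :=
  h.mem_locus_of_not hAB hB (locus_mono p Set.subset_union_left hab) hb fun hba => h.asymm hab hba

theorem lt_or_lt {a b c : C} (hab : b ∈ locus p (A ∪ {a})) (hc : c ∈ locus p A) :
    c ∈ locus p (A ∪ {a}) ∨ b ∈ locus p (A ∪ {c}) := by
  by_contra! hn
  exact hn.1 (h.mem_locus_of_not Set.subset_union_left (h.small₁ a) hc hab hn.2)

theorem exists_gt (a : C) : ∃ b, b ∈ locus p (A ∪ {a}) :=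
  h.monster.locus_nonempty (h.small₁ a) p

theorem exists_lt {a : C} (ha : a ∈ locus p A) :
    ∃ b ∈ locus p A, a ∈ locus p (A ∪ {b}) := by
  obtain ⟨c, hc⟩ := h.exists_gt a
  have hcA := locus_mono p Set.subset_union_left hc
  obtain ⟨b, hb⟩ := h.monster.exists_tp2_eq' h.small (tp1_eq_of_mem_locus hcA ha) a
  exact ⟨b, mem_locus_of_tp1_eq (tp2_left hb) ha,
    h.invariant.mem_locus subset_rfl hb hc⟩

theorem mem_locus_union_finset {B : Set C} (hAB : A ⊆ B) (hB : IsSmall B) {b : C}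
    (hb : b ∈ locus p B) (F : Finset C) (hF : ∀ x ∈ F, x ∈ locus p A ∧ x ∉ locus p B) :
    b ∈ locus p (B ∪ F) ∧ IsSmall (B ∪ F) := by
  classical
  induction F using Finset.induction_on with
  | empty => simpa using ⟨hb, hB⟩
  | insert x F _ ih =>
    obtain ⟨h1, h2⟩ := ih fun y hy => hF y (Finset.mem_insert_of_mem hy)
    obtain ⟨hx, hxB⟩ := hF x (Finset.mem_insert_self x F)
    have e : B ∪ ((insert x F : Finset C) : Set C) = B ∪ F ∪ {x} := by
      rw [Finset.coe_insert, Set.union_assoc, Set.union_comm (F : Set C), Set.insert_eq]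
    rw [e]
    exact ⟨h.absorb (hAB.trans Set.subset_union_left) h2 hx
      (fun hx' => hxB (locus_mono p Set.subset_union_left hx')) h1, h.monster.small_insert h2 x⟩

/-- Pairwise conditions suffice for Morley sequences: an element which forms a Morley pair with
each element of `X` realizes the restriction of `p` to `A ∪ X`. -/
theorem mem_locus_union {X : Set C} (hX : X ⊆ locus p A) {b : C} (hb : b ∈ locus p A)
    (hbX : ∀ x ∈ X, b ∈ locus p (A ∪ {x})) : b ∈ locus p (A ∪ X) := by
  classical
  suffices key : ∀ F : Finset C, (F : Set C) ⊆ X →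
      b ∈ locus p (A ∪ F) ∧ IsSmall (A ∪ (F : Set C)) by
    refine mem_locus_of_finite fun F hF => ?_
    refine locus_mono p (fun x hx => ?_) (key (F.filter (· ∈ X)) fun y hy => ?_).1
    rcases hF hx with hA | hxX
    · exact Or.inl hA
    · exact Or.inr (Finset.mem_coe.2 (Finset.mem_filter.2 ⟨hx, hxX⟩))
    · exact (Finset.mem_filter.1 (Finset.mem_coe.1 hy)).2
  intro F
  induction F using Finset.induction_on with
  | empty => intro _; simpa using ⟨hb, h.small⟩
  | insert x F _ ih =>
    intro hF
    rw [Finset.coe_insert, Set.insert_subset_iff] at hF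
    obtain ⟨h1, h2⟩ := ih hF.2
    have e : A ∪ ((insert x F : Finset C) : Set C) = A ∪ F ∪ {x} := by
      rw [Finset.coe_insert, Set.union_assoc, Set.union_comm (F : Set C), Set.insert_eq]
    have e' : A ∪ F ∪ {x} = A ∪ {x} ∪ F := by
      rw [Set.union_assoc, Set.union_assoc, Set.union_comm (F : Set C)]
    rw [e]
    refine ⟨?_, h.monster.small_insert h2 x⟩
    by_cases hx : x ∈ locus p (A ∪ F)
    · rw [e']
      refine (h.mem_locus_union_finset Set.subset_union_left (h.small₁ x) (hbX x hF.1) F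
        fun y hy => ⟨hX (hF.2 hy), fun hyx => h.asymm hyx (locus_mono p ?_ hx)⟩).1
      exact Set.union_subset_union_right A (Set.singleton_subset_iff.2 hy)
    · exact h.absorb Set.subset_union_left h2 (hX hF.1) hx h1

theorem isMorley_iff {I : Type*} [LinearOrder I] {a : I → C} :
    IsMorley p A a ↔
      (∀ i, a i ∈ locus p A) ∧ ∀ i j, i < j → a j ∈ locus p (A ∪ {a i}) := by
  constructor
  · refine fun ha => ⟨fun i => locus_mono p Set.subset_union_left (ha i), fun i j hij => ?_⟩
    exact locus_mono p (Set.union_subset_union_right A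
      (Set.singleton_subset_iff.2 (Set.mem_image_of_mem a (Set.mem_Iio.2 hij)))) (ha j)
  · rintro ⟨ha, hlt⟩ i
    refine h.mem_locus_union ?_ (ha i) ?_
    · rintro _ ⟨j, -, rfl⟩
      exact ha j
    · rintro _ ⟨j, hj, rfl⟩
      exact hlt j i hj

/-- Maximal Morley sequences in `X` are exactly the transversals of the classes of incomparable
elements, so `Inv_{p,A}(X)` is the order type of the quotient. -/
theorem isInv {X : Set C} {I : Type w} [LinearOrder I]
    {π : {a : C // a ∈ locus p A ∧ a ∈ X} → I} (hπ : Function.Surjective π)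
    (hlt : ∀ x y, π x < π y ↔ (y : C) ∈ locus p (A ∪ {(x : C)})) : IsInv p A X I := by
  classical
  have hmax : ∀ (I' : Type w) [LinearOrder I'] (a : I' → C), (∀ i, a i ∈ X) → IsMorley p A a →
      ∃ g : I' ↪o I, ∃ x : I' → {a : C // a ∈ locus p A ∧ a ∈ X},
        (∀ i, (x i : C) = a i) ∧ ∀ i, g i = π (x i) := by
    intro I' _ a haX ha
    rw [h.isMorley_iff] at ha
    refine ⟨OrderEmbedding.ofStrictMono (fun i => π ⟨a i, ha.1 i, haX i⟩) fun i j hij =>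
      (hlt _ _).2 (ha.2 i j hij), fun i => ⟨a i, ha.1 i, haX i⟩, fun _ => rfl, fun _ => rfl⟩
  have hsec : ∀ s : I → {a : C // a ∈ locus p A ∧ a ∈ X}, (∀ i, π (s i) = i) →
      IsMorley p A fun i => (s i : C) := by
    intro s hs
    refine h.isMorley_iff.2 ⟨fun i => (s i).2.1, fun i j hij => (hlt _ _).1 ?_⟩
    rwa [hs, hs]
  constructor
  · let s := Function.surjInv hπ
    have hs : ∀ i, π (s i) = i := Function.surjInv_eq hπ
    refine ⟨fun i => (s i : C), fun i => (s i).2.2, hsec s hs, ?_⟩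
    intro J _ b f hbX hb hbf
    obtain ⟨g, x, hx, hg⟩ := hmax J b hbX hb
    intro j
    refine ⟨g j, g.injective ?_⟩
    have : x (f (g j)) = s (g j) := Subtype.ext ((hx _).trans (congrFun hbf (g j)))
    rw [hg (f (g j)), this, hs]
  · intro I' _ a' ha'
    obtain ⟨g, x, hx, hg⟩ := hmax I' a' ha'.mem ha'.morley
    let s : I → {a : C // a ∈ locus p A ∧ a ∈ X} := fun i =>
      if hi : ∃ i', g i' = i then x hi.choose else Function.surjInv hπ i
    have hs : ∀ i, π (s i) = i := by
      intro i
      by_cases hi : ∃ i', g i' = i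
      · simp only [s, dif_pos hi]
        rw [← hg, hi.choose_spec]
      · simp only [s, dif_neg hi]
        exact Function.surjInv_eq hπ i
    have hsg : ∀ i', s (g i') = x i' := by
      intro i'
      have hi : ∃ j, g j = g i' := ⟨i', rfl⟩
      simp only [s, dif_pos hi]
      exact congrArg x (g.injective hi.choose_spec)
    have hsurj := ha'.maximal I (fun i => (s i : C)) g (fun i => (s i).2.2) (hsec s hs)
      (funext fun i' => by rw [Function.comp_apply, hsg, hx])
    exact ⟨g.strictMono.orderIsoOfSurjective g hsurj⟩

theorem exists_inv (X : Set C) : ∃ (I : Type w) (_ : LinearOrder I)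
    (π : {a : C // a ∈ locus p A ∧ a ∈ X} → I), Function.Surjective π ∧
      ∀ x y, π x < π y ↔ (y : C) ∈ locus p (A ∪ {(x : C)}) :=
  exists_linearOrder_quotient _ (fun _ _ hxy hyx => h.asymm hxy hyx)
    (fun _ _ z hxy => h.lt_or_lt hxy z.2.1)

end ConvexRegular

end Single

/-! ### Pairs of non-orthogonal types -/

section Pair

variable {L : FirstOrder.Language.{u, v}} {C : Type w} [L.Structure C]
  {p q : GlobalType L C} {A : Set C}

/-- A definable set whose trace on the locus of `q` lies in a single class is `q`-bounded. -/
theorem ConvexRegular.isBoundedSet_of_class (h : ConvexRegular q A) {D : Set C} {b : C}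
    (hb : b ∈ locus q A) (hbD : b ∈ D)
    (hD : ∀ y ∈ D, y ∈ locus q A → y ∉ locus q (A ∪ {b}) ∧ b ∉ locus q (A ∪ {y})) :
    IsBoundedSet q A D := by
  obtain ⟨ρ, hρ, -⟩ := h.convex
  obtain ⟨c, hc, hcb⟩ := h.exists_lt hb
  obtain ⟨c', hc'⟩ := h.exists_gt b
  refine ⟨⟨b, hbD, hb⟩, ρ, hρ, c, hc, c', locus_mono q Set.subset_union_left hc', ?_⟩
  rintro y ⟨hyD, hy⟩
  obtain ⟨h1, h2⟩ := hD y hyD hy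
  exact ⟨hρ.increasing _ _ ⟨hc, (h.lt_or_lt hcb hy).resolve_right h2⟩,
    hρ.increasing _ _ ⟨hy, (h.lt_or_lt hc' hy).resolve_left h1⟩⟩

/-- Two weakly non-orthogonal types over `A` that satisfy the standing hypotheses. -/
structure NonorthPair (p q : GlobalType L C) (A : Set C) : Prop where
  left : ConvexRegular p A
  right : ConvexRegular q A
  nonorth : ¬ WeaklyOrthogonal (restrict p A) (restrict q A)

/-- Realizations of `p` and `q` over `A` that are independent in one order are independent in the
other one. -/
def Commute (p q : GlobalType L C) (A : Set C) : Prop :=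
  ∀ a ∈ locus p A, ∀ b ∈ locus q A, b ∈ locus q (A ∪ {a}) ↔ a ∈ locus p (A ∪ {b})

/-- No realizations of `p` and `q` over `A` are independent in both orders. -/
def NeverCommute (p q : GlobalType L C) (A : Set C) : Prop :=
  ∀ a b, b ∈ locus q (A ∪ {a}) → a ∉ locus p (A ∪ {b})

theorem Commute.symm (h : Commute p q A) : Commute q p A :=
  fun b hb a ha => (h a ha b hb).symm

theorem NeverCommute.symm (h : NeverCommute p q A) : NeverCommute q p A :=
  fun b a hab hba => h a b hba hab

/-- Independence over `B` from some realization of `q` holds for all realizations of `p`, as they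
have the same type over `B`. -/
theorem exists_mem_locus_union_singleton {p : GlobalType L C} (hp : ConvexRegular p A)
    (q : GlobalType L C)
    {B : Set C} (hB : IsSmall B) {c : C} (hc : c ∈ locus p B) (hAB : A ⊆ B) :
    ∃ b ∈ locus q B, c ∈ locus p (B ∪ {b}) := by
  obtain ⟨b, hb⟩ := hp.monster.locus_nonempty hB q
  obtain ⟨c', hc'⟩ := hp.monster.locus_nonempty (hp.monster.small_insert hB b) p
  obtain ⟨b', hb'⟩ := hp.monster.exists_tp2_eq' hB
    (tp1_eq_of_mem_locus (locus_mono p Set.subset_union_left hc') hc) b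
  exact ⟨b', mem_locus_of_tp1_eq (tp2_left hb') hb, hp.invariant.mem_locus hAB hb' hc'⟩

namespace NonorthPair

variable (h : NonorthPair p q A)
include h

theorem symm : NonorthPair q p A :=
  ⟨h.right, h.left, fun ho => h.nonorth fun a a' b b' ha ha' hb hb' =>
    tp2_swap (ho b b' a a' hb hb' ha ha')⟩

theorem exists_not_mem_locus {a : C} (ha : a ∈ locus p A) :
    ∃ b ∈ locus q A, b ∉ locus q (A ∪ {a}) := by
  by_contra! hcon
  have key : ∀ a₁ ∈ locus p A, ∀ b₁ ∈ locus q A, b₁ ∈ locus q (A ∪ {a₁}) := by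
    intro a₁ ha₁ b₁ hb₁
    obtain ⟨b, hb⟩ := h.left.monster.exists_tp2_eq h.left.small (tp1_eq_of_mem_locus ha₁ ha) b₁
    exact h.right.invariant.mem_locus subset_rfl hb.symm
      (hcon b (mem_locus_of_tp1_eq (tp2_right hb) hb₁))
  exact h.nonorth fun a a' b b' ha ha' hb hb' =>
    h.right.invariant.tp2_eq subset_rfl (tp1_eq_of_mem_locus (p := p) ha ha')
      (key a ha b hb) (key a' ha' b' hb')

theorem exists_not_mem_locus' {a : C} (ha : a ∈ locus p A) :
    ∃ b ∈ locus q A, a ∉ locus p (A ∪ {b}) := by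
  obtain ⟨b, hb⟩ := h.left.monster.locus_nonempty h.left.small q
  obtain ⟨a', ha', hab⟩ := h.symm.exists_not_mem_locus hb
  obtain ⟨b', hb'⟩ := h.left.monster.exists_tp2_eq' h.left.small (tp1_eq_of_mem_locus ha' ha) b
  exact ⟨b', mem_locus_of_tp1_eq (tp2_left hb') hb, fun hn =>
    hab (h.left.invariant.mem_locus subset_rfl hb'.symm hn)⟩

/-- An element `e` that does not affect `q` over `B` does not affect `p` over `B` either, provided
that non-orthogonality persists over `B`. Otherwise, realizations `c` of `p` over `B` that depend
on `e` would lie both above and below those independent from `e`: as all realizations of `q` over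
`B` look alike over `B ∪ {e}`, such a `c` can be found above any of them. -/
theorem locus_subset_of_locus_subset {B : Set C} (hAB : A ⊆ B) (hB : IsSmall B)
    (hN : ∀ d ∈ locus p B, ∃ b ∈ locus q B, d ∉ locus p (B ∪ {b})) {e : C}
    (he : locus q B ⊆ locus q (B ∪ {e})) : locus p B ⊆ locus p (B ∪ {e}) := by
  intro c hc
  by_contra hce
  have hBe := h.left.monster.small_insert hB e
  obtain ⟨d, hd⟩ := h.left.monster.locus_nonempty hBe p
  have hdB := locus_mono p Set.subset_union_left hd
  obtain ⟨b, hb, hdb⟩ := hN d hdB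
  obtain ⟨b₀, hb₀, hcb₀⟩ := exists_mem_locus_union_singleton h.left q hB hc hAB
  obtain ⟨c₀, hc₀⟩ := h.left.monster.exists_tp2_eq hBe
    (tp1_eq_of_mem_locus (he hb₀) (he hb)) c
  have hc₀b := h.left.invariant.mem_locus hAB (tp2_mono Set.subset_union_left hc₀) hcb₀
  have hc₀e : c₀ ∉ locus p (B ∪ {e}) := fun hn =>
    hce (mem_locus_of_tp1_eq (tp2_right hc₀).symm hn)
  have hc₀A := locus_mono p (hAB.trans Set.subset_union_left) hc₀b
  have h1 := h.left.absorb (hAB.trans Set.subset_union_left) (h.left.monster.small_insert hB b)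
    (locus_mono p hAB hdB) hdb hc₀b
  have h2 := h.left.absorb (hAB.trans Set.subset_union_left) hBe hc₀A hc₀e hd
  exact h.left.asymm
    (locus_mono p (Set.union_subset_union_left _ (hAB.trans Set.subset_union_left)) h1)
    (locus_mono p (Set.union_subset_union_left _ (hAB.trans Set.subset_union_left)) h2)

theorem absorb_of_neverCommute (hnc : NeverCommute p q A) {B : Set C} (hAB : A ⊆ B)
    (hB : IsSmall B) {b c : C} (hb : b ∈ locus q A) (hbB : b ∉ locus q B) (hc : c ∈ locus p B) :
    c ∈ locus p (B ∪ {b}) := by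
  refine h.locus_subset_of_locus_subset hAB hB (fun d hd => ?_)
    (fun x hx => h.right.absorb hAB hB hb hbB hx) hc
  obtain ⟨b', hb'⟩ := h.left.monster.locus_nonempty (h.left.monster.small_insert hB d) q
  refine ⟨b', locus_mono q Set.subset_union_left hb', fun hn => hnc d b' ?_ ?_⟩
  · exact locus_mono q (Set.union_subset_union_left _ hAB) hb'
  · exact locus_mono p (Set.union_subset_union_left _ hAB) hn

/-- In the non-commuting case independence extends `◁` to a strict weak order on both loci: if `b'`
does not lie above `b` and `b` lies below `a`, then `b'` lies below `a`. -/
theorem lt_of_neverCommute (hnc : NeverCommute p q A) {a b b' : C} (hb : b' ∈ locus q A)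
    (hbb' : b' ∉ locus q (A ∪ {b})) (hab : a ∈ locus p (A ∪ {b})) : a ∈ locus p (A ∪ {b'}) :=
  locus_mono p (Set.union_subset_union_left _ Set.subset_union_left)
    (h.absorb_of_neverCommute hnc Set.subset_union_left (h.left.small₁ b) hb hbb' hab)

end NonorthPair

/-! ### Matching classes -/

/-- The classes of `a` and of `b` correspond to each other when `p` and `q` do not commute:
neither of the two is independent from the other one. -/
def Match (p q : GlobalType L C) (A : Set C) (a b : C) : Prop :=
  b ∉ locus q (A ∪ {a}) ∧ a ∉ locus p (A ∪ {b})

/-- The classes of `a` and of `b` correspond to each other when `p` and `q` commute: each of them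
is maximal among the classes that are dependent on the other one. -/
def CoMatch (p q : GlobalType L C) (A : Set C) (a b : C) : Prop :=
  b ∉ locus q (A ∪ {a}) ∧ (∀ b' ∈ locus q (A ∪ {b}), b' ∈ locus q (A ∪ {a})) ∧
    ∀ a' ∈ locus p (A ∪ {a}), a' ∈ locus p (A ∪ {b})

theorem Match.symm {a b : C} (h : Match p q A a b) : Match q p A b a := ⟨h.2, h.1⟩

theorem CoMatch.symm (hc : Commute p q A) {a b : C} (ha : a ∈ locus p A) (hb : b ∈ locus q A)
    (h : CoMatch p q A a b) : CoMatch q p A b a :=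
  ⟨fun hn => h.1 ((hc a ha b hb).2 hn), h.2.2, h.2.1⟩

namespace NonorthPair

variable (h : NonorthPair p q A)
include h

theorem lt_of_match (hnc : NeverCommute p q A) {a b a' b' : C} (hb : b ∈ locus q A)
    (hb' : b' ∈ locus q A) (hab : Match p q A a b) (hab' : Match p q A a' b')
    (haa' : a' ∈ locus p (A ∪ {a})) : b' ∈ locus q (A ∪ {b}) := by
  have h1 := locus_mono p (Set.union_subset_union_left _ Set.subset_union_left)
    (h.absorb_of_neverCommute hnc Set.subset_union_left (h.left.small₁ a) hb hab.1 haa')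
  by_contra hn
  exact hab'.2 (h.lt_of_neverCommute hnc hb' hn h1)

theorem lt_iff_of_match (hnc : NeverCommute p q A) {a b a' b' : C} (ha : a ∈ locus p A)
    (ha' : a' ∈ locus p A) (hb : b ∈ locus q A) (hb' : b' ∈ locus q A) (hab : Match p q A a b)
    (hab' : Match p q A a' b') : a' ∈ locus p (A ∪ {a}) ↔ b' ∈ locus q (A ∪ {b}) :=
  ⟨h.lt_of_match hnc hb hb' hab hab', h.symm.lt_of_match hnc.symm ha ha' hab.symm hab'.symm⟩

theorem lt_of_coMatch (hc : Commute p q A) {a b a' b' : C}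
    (ha' : a' ∈ locus p A) (hb : b ∈ locus q A) (hb' : b' ∈ locus q A) (hab : CoMatch p q A a b)
    (hab' : CoMatch p q A a' b') (haa' : a' ∈ locus p (A ∪ {a})) : b ∈ locus q (A ∪ {b'}) :=
  locus_mono q (Set.union_subset_union_left _ Set.subset_union_left)
    (h.right.absorb Set.subset_union_left (h.left.small₁ a') hb' hab'.1
      ((hc a' ha' b hb).2 (hab.2.2 a' haa')))

theorem lt_iff_of_coMatch (hc : Commute p q A) {a b a' b' : C} (ha : a ∈ locus p A)
    (ha' : a' ∈ locus p A) (hb : b ∈ locus q A) (hb' : b' ∈ locus q A) (hab : CoMatch p q A a b)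
    (hab' : CoMatch p q A a' b') : a' ∈ locus p (A ∪ {a}) ↔ b ∈ locus q (A ∪ {b'}) :=
  ⟨h.lt_of_coMatch hc ha' hb hb' hab hab',
    h.symm.lt_of_coMatch hc.symm hb ha' ha (hab'.symm hc ha' hb') (hab.symm hc ha hb)⟩

end NonorthPair

/-! ### The bounded case -/

/-- The relation `r` is definable over `A` and assigns to each realization `a` of `p` over `A` a
nonempty set `r(a, C)` of realizations of `q` over `A` that are dependent on `a` and have a common
lower bound in the order of Morley pairs. There always is an upper bound: any realization of the
restriction of `q` to `A ∪ {a}`. -/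
structure IsBoundedRelation (p q : GlobalType L C) (A : Set C) (r : C → C → Prop) : Prop where
  def2 : Def2 L A r
  exists_rel : ∀ a ∈ locus p A, ∃ y, r a y
  mem : ∀ a ∈ locus p A, ∀ y, r a y → y ∈ locus q A
  dependent : ∀ a ∈ locus p A, ∀ y, r a y → y ∉ locus q (A ∪ {a})
  lower_bound : ∀ a ∈ locus p A, ∃ c ∈ locus q A, ∀ y, r a y → y ∈ locus q (A ∪ {c})

namespace NonorthPair

variable (h : NonorthPair p q A)
include h

/-- In the bounded case such a relation exists: a formula `θ(a, y)` with bounded trace on the locus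
of `q` is cut down to this trace, which is possible as convexity makes the trace definable. -/
theorem exists_bounded_relation (hbd : BoundedKind p q A) :
    ∃ r, IsBoundedRelation p q A r := by
  obtain ⟨a, ha, b, hb, θ, hθ, -, ρ, hρ, c, hc, c', hc', hcd⟩ := hbd
  have hM := h.left.monster
  obtain ⟨lt, hltd, hirr, htr, hlt, hconv⟩ := h.right.exists_witness
  -- Bounds for a given witness of asymmetry are replaced by bounds in the sense of Morley pairs.
  obtain ⟨c₀, hc₀, hc₀c⟩ := h.right.exists_lt hc
  obtain ⟨c₁, hc₁⟩ := h.right.exists_gt c'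
  have hc₁A := locus_mono q Set.subset_union_left hc₁
  have hbound : ∀ y ∈ locus q A, Sat θ ![a, y] →
      y ∈ locus q (A ∪ {c₀}) ∧ c₁ ∈ locus q (A ∪ {y}) := by
    intro y hy hθy
    obtain ⟨h1, h2⟩ := hcd y ⟨hθy, hy⟩
    refine ⟨(h.right.lt_or_lt hc₀c hy).resolve_right fun hn => ?_,
      (h.right.lt_or_lt hc₁ hy).resolve_left fun hn => ?_⟩
    · exact hρ.irrefl _ (hρ.trans _ _ _ h1 (hρ.increasing _ _ ⟨hy, hn⟩))
    · exact hρ.irrefl _ (hρ.trans _ _ _ h2 (hρ.increasing _ _ ⟨hc', hn⟩))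
  have hθd : Def2 L A fun x y => Sat θ ![x, y] := ⟨θ, fun _ _ => Iff.rfl⟩
  have i1 : A ∪ {a} ⊆ A ∪ {a} ∪ {c₀} ∪ {c₁} := by
    rw [Set.union_assoc _ {c₀}]; exact Set.subset_union_left
  have i2 : A ∪ {c₀} ⊆ A ∪ {a} ∪ {c₀} ∪ {c₁} :=
    (Set.union_subset_union_left _ Set.subset_union_left).trans Set.subset_union_left
  have i3 : A ∪ {c₁} ⊆ A ∪ {a} ∪ {c₀} ∪ {c₁} :=
    Set.union_subset_union_left _ (Set.subset_union_left.trans Set.subset_union_left)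
  obtain ⟨t, htd, hqt, ht⟩ := hM.exists_holds_disjoint (B := A)
    (hM.small_insert (h.left.small₂ a c₀) c₁) (Set.subset_union_left.trans i1) (p := q)
    (((hθd.fiber a).mono i1).and
      (((hltd.fiber c₀).mono i2).and ((hltd.swap.fiber c₁).mono i3)).not)
    (fun y hy hn => hn.2
      ⟨hlt _ hc₀ _ (hbound y hy hn.1).1, hlt _ hy _ (hbound y hy hn.1).2⟩)
  let r : C → C → Prop := fun x y => Sat θ ![x, y] ∧ t y
  have hrd : Def2 L A r := hθd.and htd.right
  have hrQ : ∀ y, r a y → y ∈ locus q A := by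
    intro y hy
    by_contra hn
    refine ht y hy.2 ⟨hy.1, fun hcy => hn (hconv _ hc₀ _ hc₁A y hcy.1 hcy.2)⟩
  have hrq : ∀ y, r a y → y ∉ locus q (A ∪ {a}) := by
    intro y hy hya
    obtain ⟨z, hz⟩ := hM.locus_nonempty (h.left.small₂ a c₁) q
    have hrz : r a z := tp1_eq_iff.1
      (tp1_eq_of_mem_locus hya (locus_mono q Set.subset_union_left hz)) _ (hrd.fiber a) hy
    exact h.right.asymm (hbound z (hrQ z hrz) hrz.1).2
      (locus_mono q (Set.union_subset_union_left _ Set.subset_union_left) hz)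
  -- What holds for `a` holds for all other realizations of `p` over `A` as well.
  have key : ∀ a' ∈ locus p A, ∀ y, r a' y → ∃ y', r a y' ∧ tp L A ![a', y] = tp L A ![a, y'] := by
    intro a' ha' y hy
    obtain ⟨y', hy'⟩ := hM.exists_tp2_eq h.left.small (tp1_eq_of_mem_locus ha' ha) y
    exact ⟨y', tp2_eq_iff.1 hy' r hrd hy, hy'⟩
  have hmem : ∀ a' ∈ locus p A, ∀ y, r a' y → y ∈ locus q A := fun a' ha' y hy => by
    obtain ⟨y', hr, hy'⟩ := key a' ha' y hy
    exact mem_locus_of_tp1_eq (tp2_right hy').symm (hrQ y' hr)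
  refine ⟨r, hrd, fun a' ha' => ?_, hmem, fun a' ha' y hy hn => ?_, fun a' ha' => ?_⟩
  · exact tp1_eq_iff.1 (tp1_eq_of_mem_locus ha ha') _ hrd.exists
      ⟨b, hθ, mem_locus_iff.1 hb t htd hqt⟩
  · obtain ⟨y', hr, hy'⟩ := key a' ha' y hy
    exact hrq y' hr (h.right.invariant.mem_locus subset_rfl hy' hn)
  · have haa' := tp1_eq_of_mem_locus ha ha'
    obtain ⟨d, hd⟩ := hM.exists_tp2_eq h.left.small haa' c₀
    have hdA := mem_locus_of_tp1_eq (tp2_right hd) hc₀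
    obtain ⟨d₀, hd₀, hd₀d⟩ := h.right.exists_lt hdA
    have hdlt := tp2_eq_iff.1 hd _ (hrd.exists_and hltd.not).not (by
      rintro ⟨y, hy, hn⟩
      exact hn (hlt _ hc₀ _ (hbound y (hrQ y hy) hy.1).1))
    refine ⟨d₀, hd₀, fun y hy => ?_⟩
    have hyA := hmem a' ha' y hy
    refine (h.right.lt_or_lt hd₀d hyA).resolve_right fun hn => ?_
    have hdy : lt d y := by
      by_contra hnot
      exact hdlt ⟨y, hy, hnot⟩
    exact hirr _ (htr _ _ _ hdy (hlt y hyA d hn))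

theorem match_of_bounded (hnc : NeverCommute p q A) {r : C → C → Prop}
    (hr : IsBoundedRelation p q A r) {a b : C} (ha : a ∈ locus p A)
    (hab : r a b) : Match p q A a b := by
  obtain ⟨c, hc, hcr⟩ := hr.lower_bound a ha
  refine ⟨hr.dependent a ha b hab, fun hn => ?_⟩
  have hbc := hcr b hab
  -- A lower bound `c` of `r(a, C)` would have the same type over `A ∪ {a}` as `b`.
  have hac := h.lt_of_neverCommute hnc hc (fun hcb => h.right.asymm hbc hcb) hn
  have htp := h.left.invariant.tp2_eq subset_rfl
    (tp1_eq_of_mem_locus (p := q) (hr.mem a ha b hab) hc) hn hac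
  have hcc := hcr c (tp2_eq_iff.1 (tp2_swap htp) r hr.def2 hab)
  exact h.right.asymm hcc hcc

/-- If `b` was not in the last class that is dependent on `a`, then copies `(a₂, b₂)` of `(a, b)`
with arbitrarily large `a₂`, hence with arbitrarily small `b₂`, could be found such that all `b₂`
are related to one fixed element `a₁`. This contradicts the lower bound of `r(a₁, C)`. -/
theorem coMatch_of_bounded (hcm : Commute p q A) {r : C → C → Prop}
    (hr : IsBoundedRelation p q A r) {a b : C} (ha : a ∈ locus p A)
    (hab : r a b) : CoMatch p q A a b := by
  have hM := h.left.monster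
  have claim : ∀ b, r a b → ∀ b' ∈ locus q (A ∪ {b}), b' ∈ locus q (A ∪ {a}) := by
    intro b hab b' hb'
    by_contra hn
    have hb := hr.mem a ha b hab
    obtain ⟨b₁, hb₁⟩ := hM.locus_nonempty (h.left.small₂ a b) q
    have hb₁a := locus_mono q Set.subset_union_left hb₁
    have hb₁b : b₁ ∈ locus q (A ∪ {b}) :=
      locus_mono q (Set.union_subset_union_left _ Set.subset_union_left) hb₁
    have hb₁A := locus_mono q Set.subset_union_left hb₁a
    obtain ⟨a₁, ha₁⟩ := hM.exists_tp2_eq (h.left.small₁ b) (tp1_eq_of_mem_locus hb' hb₁b) a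
    have ha₁A := mem_locus_of_tp1_eq (tp1_mono Set.subset_union_left (tp2_right ha₁)) ha
    have hb₁a₁ : b₁ ∉ locus q (A ∪ {a₁}) := fun hn' => hn <|
      h.right.invariant.mem_locus subset_rfl
        (tp2_swap (tp2_mono Set.subset_union_left ha₁)).symm hn'
    have ha₁b : r a₁ b :=
      tp2_eq_iff.1 (tp2_swap (tp2_same_left.2 (tp2_right ha₁))) r hr.def2 hab
    -- `a₁` lies below `a`, so that `a` realizes the restriction of `p` to `A ∪ {b₁, a₁}`.
    have haD := h.left.absorb Set.subset_union_left (h.left.small₁ b₁) ha₁A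
      (fun hn' => hb₁a₁ ((hcm a₁ ha₁A b₁ hb₁A).2 hn')) ((hcm a ha b₁ hb₁A).1 hb₁a)
    obtain ⟨c, hc, hcr⟩ := hr.lower_bound a₁ ha₁A
    obtain ⟨a₂, ha₂⟩ := hM.locus_nonempty (hM.small_insert (h.left.small₂ b₁ a₁) c) p
    have ha₂D := locus_mono p Set.subset_union_left ha₂
    have ha₂A := locus_mono p (Set.subset_union_left.trans Set.subset_union_left) ha₂D
    have ha₂c : a₂ ∈ locus p (A ∪ {c}) := locus_mono p
      (Set.union_subset_union_left _ (Set.subset_union_left.trans Set.subset_union_left)) ha₂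
    obtain ⟨b₂, hb₂⟩ := hM.exists_tp2_eq (h.left.small₂ b₁ a₁) (tp1_eq_of_mem_locus haD ha₂D) b
    have ha₂b₂ : r a₂ b₂ := tp2_eq_iff.1
      (tp2_mono (Set.subset_union_left.trans Set.subset_union_left) hb₂) r hr.def2 hab
    have ha₁b₂ : r a₁ b₂ := tp1_eq_iff.1 (tp2_right hb₂) (r a₁)
      ((hr.def2.fiber a₁).mono (Set.union_subset_union_left _ Set.subset_union_left)) ha₁b
    -- Hence `r(a₁, C)` has an element below its lower bound `c`.
    exact h.right.asymm (hcr b₂ ha₁b₂)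
      (locus_mono q (Set.union_subset_union_left _ Set.subset_union_left)
        (h.right.absorb Set.subset_union_left (h.left.small₁ a₂) (hr.mem a₂ ha₂A b₂ ha₂b₂)
          (hr.dependent a₂ ha₂A b₂ ha₂b₂)
          ((hcm a₂ ha₂A c hc).2 ha₂c)))
  have hb := hr.mem a ha b hab
  have hba := hr.dependent a ha b hab
  refine ⟨hba, claim b hab, fun a' ha' => ?_⟩
  by_contra hn
  obtain ⟨a₂, ha₂⟩ := hM.locus_nonempty (h.left.small₂ a b) p
  have ha₂a := locus_mono p Set.subset_union_left ha₂
  have ha₂A := locus_mono p Set.subset_union_left ha₂a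
  have ha₂b : a₂ ∈ locus p (A ∪ {b}) :=
    locus_mono p (Set.union_subset_union_left _ Set.subset_union_left) ha₂
  obtain ⟨b₂, hb₂⟩ := hM.exists_tp2_eq (h.left.small₁ a) (tp1_eq_of_mem_locus ha' ha₂a) b
  have hab₂ : r a b₂ := tp1_eq_iff.1 (tp2_right hb₂) (r a) (hr.def2.fiber a) hab
  have hb₂A := hr.mem a ha b₂ hab₂
  have ha₂b₂ : a₂ ∉ locus p (A ∪ {b₂}) := fun hn' => hn <|
    h.left.invariant.mem_locus subset_rfl
      (tp2_swap (tp2_mono Set.subset_union_left hb₂)).symm hn'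
  refine hba (claim b₂ hab₂ b ?_)
  exact locus_mono q (Set.union_subset_union_left _ Set.subset_union_left)
    (h.right.absorb Set.subset_union_left (h.left.small₁ a₂) hb₂A
      (fun hn' => ha₂b₂ ((hcm a₂ ha₂A b₂ hb₂A).1 hn')) ((hcm a₂ ha₂A b hb).2 ha₂b))

/-- The bounded kind of non-orthogonality is symmetric, because matching is one-to-one between
classes. -/
theorem boundedKind_symm_of_inj (hbd : BoundedKind p q A) {S : C → C → Prop}
    (hS : ∀ r, IsBoundedRelation p q A r → ∀ a ∈ locus p A, ∀ b, r a b → S a b)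
    (hinj : ∀ a ∈ locus p A, ∀ a' ∈ locus p A, ∀ b ∈ locus q A, S a b → S a' b →
      a' ∉ locus p (A ∪ {a})) : BoundedKind q p A := by
  obtain ⟨r, hr⟩ := h.exists_bounded_relation hbd
  obtain ⟨a, ha⟩ := h.left.monster.locus_nonempty h.left.small p
  obtain ⟨b, hab⟩ := hr.exists_rel a ha
  have hb := hr.mem a ha b hab
  obtain ⟨θ, hθ⟩ := hr.def2.swap
  refine ⟨b, hb, a, ha, θ, (hθ b a).2 hab, ?_⟩
  refine h.left.isBoundedSet_of_class ha ((hθ b a).2 hab) fun x hx hxA => ?_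
  have hxb := hS r hr x hxA b ((hθ b x).1 hx)
  have hab' := hS r hr a ha b hab
  exact ⟨hinj a ha x hxA b hb hab' hxb, hinj x hxA a ha b hb hxb hab'⟩

end NonorthPair

end Pair

/-! ### Products of invariant types -/

section Tensor

variable {L : FirstOrder.Language.{u, v}} {C : Type w} [L.Structure C]
  {p q : GlobalType L C} {A : Set C}

theorem realize_plugLeft {B : Set C} (φ : FormulaOver L B (Fin 2)) (a x : C) :
    (plugLeft φ a).Realize (Sum.elim id ![x]) ↔ Sat φ ![a, x] := by
  simp only [plugLeft, Sat, FirstOrder.Language.Formula.realize_relabel]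
  apply iff_of_eq
  congr 1
  ext (b | i)
  · rfl
  · fin_cases i <;> rfl

theorem sat_swapVars {B : Set C} (φ : FormulaOver L B (Fin 2)) (a b : C) :
    Sat (swapVars φ) ![a, b] ↔ Sat φ ![b, a] := by
  simp only [swapVars, Sat, FirstOrder.Language.Formula.realize_relabel]
  apply iff_of_eq
  congr 1
  ext (b | i)
  · rfl
  · fin_cases i <;> rfl

/-- The restriction of `p ⊗ q` to `A` is the type over `A` of any pair `(a, b)` of realizations
with `b` independent from `a`. -/
theorem tensorRestrict_eq_tp (hC : IsMonster L C) (hA : IsSmall A) (hq : IsInvariant q A)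
    {a b : C} (ha : a ∈ locus p A) (hb : b ∈ locus q (A ∪ {a})) :
    tensorRestrict p q A = tp L A ![a, b] := by
  have hmem : ∀ (φ : FormulaOver L A (Fin 2)), ∀ a' ∈ locus p A,
      Mem q (plugLeft φ a') ↔ Sat φ ![a, b] := by
    intro φ a' ha'
    have hd : Def2 L A fun x y => Sat φ ![x, y] := ⟨φ, fun _ _ => Iff.rfl⟩
    obtain ⟨b', hb'⟩ := hC.locus_nonempty (hC.small_insert hA a') q
    rw [mem_iff_holds (realize_plugLeft φ a'), (hd.fiber a').holds_iff hb']
    have htp := hq.tp2_eq subset_rfl (tp1_eq_of_mem_locus ha' ha) hb' hb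
    exact ⟨tp2_eq_iff.1 htp _ hd, tp2_eq_iff.1 htp.symm _ hd⟩
  ext φ
  constructor
  · rintro ⟨B, hB, -, ψ, hφψ, hψ⟩
    have hAB : IsSmall (A ∪ B) :=
      (mk_union_le _ _).trans_lt (add_lt_of_lt hC.uncountable.le hA hB)
    obtain ⟨a', ha'⟩ := hC.locus_nonempty hAB p
    refine (hmem φ a' (locus_mono p Set.subset_union_left ha')).1 ?_
    refine (mem_congr q fun x => ?_).1 (hψ a' (locus_mono p Set.subset_union_right ha'))
    rw [← eta1 x, realize_plugLeft, realize_plugLeft, ← realize_toGlobal, ← realize_toGlobal, hφψ]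
  · exact fun hφ => ⟨A, hA, hq, φ, rfl, fun a' ha' => (hmem φ a' ha').2 hφ⟩

theorem commuteOver_iff_tp_eq (hC : IsMonster L C) (hA : IsSmall A) (hp : IsInvariant p A)
    (hq : IsInvariant q A) {a b a' b' : C} (ha : a ∈ locus p A) (hb : b ∈ locus q (A ∪ {a}))
    (hb' : b' ∈ locus q A) (ha' : a' ∈ locus p (A ∪ {b'})) :
    CommuteOver p q A ↔ tp L A ![a, b] = tp L A ![a', b'] := by
  rw [CommuteOver, tensorRestrict_eq_tp hC hA hq ha hb, tensorRestrict_eq_tp hC hA hp hb' ha']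
  have : {φ : FormulaOver L A (Fin 2) | swapVars φ ∈ tp L A ![b', a']} = tp L A ![a', b'] := by
    ext φ
    exact sat_swapVars φ b' a'
  rw [this]

namespace NonorthPair

variable (h : NonorthPair p q A)
include h

theorem commute (hcm : CommuteOver p q A) : Commute p q A := by
  have hM := h.left.monster
  intro a ha b hb
  constructor
  · intro hab
    obtain ⟨a', ha'⟩ := hM.locus_nonempty (h.left.small₁ b) p
    have := (commuteOver_iff_tp_eq hM h.left.small h.left.invariant h.right.invariant ha hab hb
      ha').1 hcm
    exact h.left.invariant.mem_locus subset_rfl (tp2_swap this).symm ha'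
  · intro hba
    obtain ⟨b', hb'⟩ := hM.locus_nonempty (h.left.small₁ a) q
    have := (commuteOver_iff_tp_eq hM h.left.small h.left.invariant h.right.invariant ha hb' hb
      hba).1 hcm
    exact h.right.invariant.mem_locus subset_rfl this hb'

theorem neverCommute (hcm : ¬ CommuteOver p q A) : NeverCommute p q A := fun _ _ hab hba =>
  hcm ((commuteOver_iff_tp_eq h.left.monster h.left.small h.left.invariant h.right.invariant
    (locus_mono p Set.subset_union_left hba) hab (locus_mono q Set.subset_union_left hab)
    hba).2 rfl)

theorem boundedKind_symm (hbd : BoundedKind p q A) : BoundedKind q p A := by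
  by_cases hcm : CommuteOver p q A
  · have hc := h.commute hcm
    refine h.boundedKind_symm_of_inj hbd (S := CoMatch p q A)
      (fun r hr a ha b hab => h.coMatch_of_bounded hc hr ha hab) ?_
    intro a ha a' ha' b hb hab hab' hn
    exact h.right.asymm ((h.lt_iff_of_coMatch hc ha ha' hb hb hab hab').1 hn)
      ((h.lt_iff_of_coMatch hc ha ha' hb hb hab hab').1 hn)
  · have hc := h.neverCommute hcm
    refine h.boundedKind_symm_of_inj hbd (S := Match p q A)
      (fun r hr a ha b hab => h.match_of_bounded hc hr ha hab) ?_
    intro a ha a' ha' b hb hab hab' hn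
    exact h.right.asymm ((h.lt_iff_of_match hc ha ha' hb hb hab hab').1 hn)
      ((h.lt_iff_of_match hc ha ha' hb hb hab hab').1 hn)

/-- In the bounded case every class that meets a model `M` is matched with another such class. -/
theorem exists_match_mem (hbd : BoundedKind p q A) {M : L.ElementarySubstructure C}
    (hAM : A ⊆ (M : Set C)) {a : C} (ha : a ∈ locus p A) (haM : a ∈ M) :
    ∃ b ∈ locus q A, b ∈ M ∧ (¬ CommuteOver p q A → Match p q A a b) ∧
      (CommuteOver p q A → CoMatch p q A a b) := by
  obtain ⟨r, hr⟩ := h.exists_bounded_relation hbd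
  obtain ⟨b, hbM, hab⟩ := (hr.def2.fiber a).exists_mem
    (Set.union_subset hAM (Set.singleton_subset_iff.2 haM)) (hr.exists_rel a ha)
  exact ⟨b, hr.mem a ha b hab, hbM,
    fun hcm => h.match_of_bounded (h.neverCommute hcm) hr ha hab,
    fun hcm => h.coMatch_of_bounded (h.commute hcm) hr ha hab⟩

end NonorthPair

theorem CommuteOver.symm (h : CommuteOver p q A) (hpq : NonorthPair p q A) :
    CommuteOver q p A := by
  by_contra hn
  obtain ⟨a, ha⟩ := hpq.left.monster.locus_nonempty hpq.left.small p
  obtain ⟨b, hb⟩ := hpq.left.monster.locus_nonempty (hpq.left.small₁ a) q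
  exact (hpq.symm.neverCommute hn).symm a b hb
    ((hpq.commute h a ha b (locus_mono q Set.subset_union_left hb)).1 hb)

end Tensor

/-! ### Isomorphisms of linear orders -/

/-- A total correspondence between two preorders that preserves and reflects the strict orders
induces an isomorphism of the quotients. -/
theorem nonempty_orderIso_of_rel {X Y I J : Type*} [LinearOrder I] [LinearOrder J] {π : X → I}
    {π' : Y → J} (hπ : Function.Surjective π) (hπ' : Function.Surjective π') {S : X → Y → Prop}
    (hX : ∀ x, ∃ y, S x y) (hY : ∀ y, ∃ x, S x y)
    (hS : ∀ x x' y y', S x y → S x' y' → (π x < π x' ↔ π' y < π' y')) : Nonempty (I ≃o J) := by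
  choose f hf using hX
  let F : I → J := fun i => π' (f (Function.surjInv hπ i))
  have hF : StrictMono F := fun i j hij => by
    refine (hS _ _ _ _ (hf _) (hf _)).1 ?_
    rwa [Function.surjInv_eq hπ, Function.surjInv_eq hπ]
  refine ⟨hF.orderIsoOfSurjective F fun j => ?_⟩
  obtain ⟨y, rfl⟩ := hπ' j
  obtain ⟨x, hxy⟩ := hY y
  refine ⟨π x, ?_⟩
  have e := Function.surjInv_eq hπ (π x)
  refine le_antisymm (not_lt.1 fun hlt => ?_) (not_lt.1 fun hlt => ?_)
  · exact absurd ((hS _ _ _ _ hxy (hf _)).2 hlt) (by rw [e]; exact lt_irrefl _)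
  · exact absurd ((hS _ _ _ _ (hf _) hxy).2 hlt) (by rw [e]; exact lt_irrefl _)

/-- A relation that is invariant under the equivalences given by `π` and `π'` descends. -/
theorem exists_rel_quotient {X Y I J : Type*} {π : X → I} {π' : Y → J} {R : X → Y → Prop}
    (hX : ∀ x x' y, π x = π x' → R x y → R x' y)
    (hY : ∀ x y y', π' y = π' y' → R x y → R x y') :
    ∃ r : I → J → Prop, ∀ x y, r (π x) (π' y) ↔ R x y :=
  ⟨fun i j => ∃ x y, π x = i ∧ π' y = j ∧ R x y, fun x y =>
    ⟨fun ⟨_, _, hx, hy, hR⟩ => hY _ _ _ hy (hX _ _ _ hx hR), fun hR => ⟨x, y, rfl, rfl, hR⟩⟩⟩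

/-- If `r i j` means `j < i` in an order on the disjoint union of `I` and `J` in which any two
elements of one of them are separated by an element of the other one, then the Dedekind
completions are isomorphic. -/
theorem nonempty_dedekindCompletion_orderIso {I J : Type*} [LinearOrder I] [LinearOrder J]
    {r : I → J → Prop} (hI : ∀ i i' j, r i j → i ≤ i' → r i' j)
    (hJ : ∀ i j j', r i j → j' ≤ j → r i j') (hIJ : ∀ i i', i < i' → ∃ j, ¬ r i j ∧ r i' j)
    (hJI : ∀ j j', j < j' → ∃ i, r i j ∧ ¬ r i j') :
    Nonempty (DedekindCompletion I ≃o DedekindCompletion J) := by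
  have gt_I : ∀ S : DedekindCompletion I, ∀ i ∈ S.1, ∃ i' ∈ S.1, i < i' := fun S i hi => by
    by_contra! hn
    exact S.2.2 i ⟨hi, hn⟩
  have gt_J : ∀ S : DedekindCompletion J, ∀ i ∈ S.1, ∃ i' ∈ S.1, i < i' := fun S i hi => by
    by_contra! hn
    exact S.2.2 i ⟨hi, hn⟩
  have lt_I : ∀ i i' j, ¬ r i j → r i' j → i < i' := fun i i' j h1 h2 =>
    not_le.1 fun hle => h1 (hI _ _ _ h2 hle)
  have lt_J : ∀ i j j', r i j → ¬ r i j' → j < j' := fun i j j' h1 h2 =>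
    not_le.1 fun hle => h2 (hJ _ _ _ h1 hle)
  let F : DedekindCompletion I → DedekindCompletion J := fun S =>
    ⟨{j | ∃ i ∈ S.1, r i j}, by
      rintro j j' hle ⟨i, hi, hij⟩
      exact ⟨i, hi, hJ _ _ _ hij hle⟩, by
      rintro j ⟨⟨i, hi, hij⟩, hmax⟩
      obtain ⟨i', hi', hlt⟩ := gt_I S i hi
      obtain ⟨j', hj', hj''⟩ := hIJ i i' hlt
      exact absurd (hmax ⟨i', hi', hj''⟩) (not_le.2 (lt_J _ _ _ hij hj'))⟩
  let G : DedekindCompletion J → DedekindCompletion I := fun T =>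
    ⟨{i | ∃ j ∈ T.1, ¬ r i j}, by
      rintro i i' hle ⟨j, hj, hij⟩
      exact ⟨j, hj, fun hn => hij (hI _ _ _ hn hle)⟩, by
      rintro i ⟨⟨j, hj, hij⟩, hmax⟩
      obtain ⟨j', hj', hlt⟩ := gt_J T j hj
      obtain ⟨i', hi', hi''⟩ := hJI j j' hlt
      exact absurd (hmax ⟨j', hj', hi''⟩) (not_le.2 (lt_I _ _ _ hij hi'))⟩
  have hGF : ∀ S, G (F S) = S := fun S => Subtype.ext <| Set.ext fun i => by
    constructor
    · rintro ⟨j, ⟨i', hi', hj⟩, hij⟩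
      exact S.2.1 (lt_I _ _ _ hij hj).le hi'
    · intro hi
      obtain ⟨i', hi', hlt⟩ := gt_I S i hi
      obtain ⟨j, hj, hj'⟩ := hIJ i i' hlt
      exact ⟨j, ⟨i', hi', hj'⟩, hj⟩
  have hFG : ∀ T, F (G T) = T := fun T => Subtype.ext <| Set.ext fun j => by
    constructor
    · rintro ⟨i, ⟨j', hj', hi⟩, hij⟩
      exact T.2.1 (lt_J _ _ _ hij hi).le hj'
    · intro hj
      obtain ⟨j', hj', hlt⟩ := gt_J T j hj
      obtain ⟨i, hi, hi'⟩ := hJI j j' hlt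
      exact ⟨i, ⟨j', hj', hi'⟩, hi⟩
  exact ⟨Equiv.toOrderIso ⟨F, G, hGF, hFG⟩
    (fun S S' hSS' j ⟨i, hi, hij⟩ => ⟨i, hSS' hi, hij⟩)
    (fun T T' hTT' i ⟨j, hj, hij⟩ => ⟨j, hTT' hj, hij⟩)⟩

/-- The cut of a dense order `J` that consists of the `j` lying strictly below some `j'` which is
not related to any element of `S`. -/
def unrelatedCut {I J : Type*} [LinearOrder J] [DenselyOrdered J] (r : I → J → Prop) (S : Set I) :
    DedekindCompletion J :=
  ⟨{j | ∃ j', j < j' ∧ ∀ i ∈ S, ¬ r i j'},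
    fun _ _ hle ⟨k, hk, hkS⟩ => ⟨k, hle.trans_lt hk, hkS⟩, by
    rintro j ⟨⟨k, hk, hkS⟩, hmax⟩
    obtain ⟨l, hjl, hlk⟩ := exists_between hk
    exact absurd (hmax ⟨k, hlk, hkS⟩) (not_le.2 hjl)⟩

theorem unrelatedCut_anti {I J : Type*} [LinearOrder J] [DenselyOrdered J] (r : I → J → Prop)
    {S S' : Set I} (h : S ⊆ S') : unrelatedCut r S' ≤ unrelatedCut r S :=
  fun _ ⟨k, hk, hkS⟩ => ⟨k, hk, fun i hi => hkS i (h hi)⟩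

theorem unrelatedCut_unrelatedCut {I J : Type*} [LinearOrder I] [LinearOrder J]
    [DenselyOrdered I] [DenselyOrdered J] {r : I → J → Prop}
    (hI : ∀ i i' j, r i j → i ≤ i' → r i' j) (hJ : ∀ i j j', r i j → j ≤ j' → r i j')
    (hIJ : ∀ i i', i < i' → ∃ j, ¬ r i j ∧ r i' j) (S : DedekindCompletion I) :
    unrelatedCut (fun j i => r i j) (unrelatedCut r S.1).1 = S := by
  refine Subtype.ext <| Set.ext fun i => ⟨?_, fun hi => ?_⟩
  · rintro ⟨i', hlt, hi'⟩
    by_contra hiS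
    -- Two separating elements are needed, to leave room for the strict inequality in the cut.
    obtain ⟨k, hik, hki'⟩ := exists_between hlt
    obtain ⟨j₁, h1, h1'⟩ := hIJ i k hik
    obtain ⟨j₂, h2, h2'⟩ := hIJ k i' hki'
    refine hi' j₂ ⟨j₁, not_le.1 fun hle => h2 (hJ _ _ _ h1' hle), fun s hs hsj => ?_⟩ h2'
    exact h1 (hI s i j₁ hsj (not_lt.1 fun his => hiS (S.2.1 his.le hs)))
  · have : ∃ i' ∈ S.1, i < i' := by
      by_contra! hn
      exact S.2.2 i ⟨hi, hn⟩
    obtain ⟨i', hi', hlt⟩ := this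
    exact ⟨i', hlt, fun j ⟨j', hjj', hj'⟩ hn => hj' i' hi' (hJ _ _ _ hn hjj'.le)⟩

/-- If `r i j` means `j < i` in an order on the disjoint union of `I` and of the reverse of `J` in
which any two elements of one of them are separated by an element of the other one, and `I` and
`J` are dense, then the Dedekind completions are anti-isomorphic. Density is needed because the
Dedekind completion of the reverse of a linear order is not, in general, the reverse of its
Dedekind completion. -/
theorem nonempty_dedekindCompletion_orderIso_dual {I J : Type*} [LinearOrder I] [LinearOrder J]
    [DenselyOrdered I] [DenselyOrdered J]
    {r : I → J → Prop} (hI : ∀ i i' j, r i j → i ≤ i' → r i' j)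
    (hJ : ∀ i j j', r i j → j ≤ j' → r i j') (hIJ : ∀ i i', i < i' → ∃ j, ¬ r i j ∧ r i' j)
    (hJI : ∀ j j', j < j' → ∃ i, ¬ r i j ∧ r i j') :
    Nonempty (DedekindCompletion I ≃o (DedekindCompletion J)ᵒᵈ) :=
  ⟨Equiv.toOrderIso
    ⟨fun S => OrderDual.toDual (unrelatedCut r S.1),
      fun T => unrelatedCut (fun j i => r i j) (OrderDual.ofDual T).1,
      fun S => unrelatedCut_unrelatedCut hI hJ hIJ S,
      fun T => congrArg OrderDual.toDual (unrelatedCut_unrelatedCut (r := fun j i => r i j)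
        (fun j j' i => hJ i j j') (fun j i i' => hI i i' j) hJI (OrderDual.ofDual T))⟩
    (fun _ _ hSS' => unrelatedCut_anti r hSS')
    (fun _ _ hTT' => unrelatedCut_anti (fun j i => r i j) hTT')⟩

/-! ### The unbounded case -/

section Unbounded

variable {L : FirstOrder.Language.{u, v}} {C : Type w} [L.Structure C]
  {p q : GlobalType L C} {A : Set C}

theorem exists_def2_of_not_mem_locus {a b : C}
    (hab : b ∉ locus q (A ∪ {a})) :
    ∃ θ : C → C → Prop, Def2 L A θ ∧ θ a b ∧ ∀ y, θ a y → y ∉ locus q (A ∪ {a}) := by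
  rw [mem_locus_iff] at hab
  push Not at hab
  obtain ⟨s, hs, hqs, hsb⟩ := hab
  obtain ⟨r, hr, hrs⟩ := hs.exists_fiber
  refine ⟨_, hr.not, fun hn => hsb ((hrs b).1 hn), fun y hy hya => hy ?_⟩
  exact (hrs y).2 ((hs.holds_iff hya).1 hqs)

namespace NonorthPair

variable (h : NonorthPair p q A)
include h

/-- In the unbounded case dependence is relatively definable: a definable set of elements that are
dependent on `a`, once it is closed downwards, leaves out no others, as the remaining ones would
provide a bounded definable set. -/
theorem exists_def2_iff (hub : ¬ BoundedKind p q A) :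
    ∃ θ : C → C → Prop, Def2 L A θ ∧
      ∀ a ∈ locus p A, ∀ b ∈ locus q A, θ a b ↔ b ∉ locus q (A ∪ {a}) := by
  have hM := h.left.monster
  obtain ⟨a₀, ha₀⟩ := hM.locus_nonempty h.left.small p
  obtain ⟨b₀, hb₀, hab₀⟩ := h.exists_not_mem_locus ha₀
  obtain ⟨θ, hθd, hθ₀, hθ⟩ := exists_def2_of_not_mem_locus hab₀
  obtain ⟨lt, hltd, hirr, htr, hlt, -⟩ := h.right.exists_witness
  obtain ⟨c, hc⟩ := h.right.exists_gt a₀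
  have hcA := locus_mono q Set.subset_union_left hc
  have hgt : ∀ y ∈ locus q A, y ∉ locus q (A ∪ {a₀}) → c ∈ locus q (A ∪ {y}) := fun y hy hn =>
    locus_mono q (Set.union_subset_union_left _ Set.subset_union_left)
      (h.right.absorb Set.subset_union_left (h.left.small₁ a₀) hy hn hc)
  obtain ⟨t, htd, hqt, ht⟩ := hM.exists_holds_disjoint (B := A) (h.left.small₂ a₀ c)
    (Set.subset_union_left.trans Set.subset_union_left) (p := q)
    (((hθd.fiber a₀).mono Set.subset_union_left).and
      ((hltd.fiber c).mono (Set.union_subset_union_left _ Set.subset_union_left)))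
    (fun z hz hn => hirr _ (htr _ _ _ hn.2 (hlt _ hz _ (hgt z hz (hθ z hn.1)))))
  let η : C → C → Prop := fun x y => ∃ z, (θ x z ∧ t z) ∧ lt y z
  have hηd : Def2 L A η := (hθd.and htd.right).exists_and hltd
  have hη : ∀ y, η a₀ y → y ∉ locus q (A ∪ {a₀}) := by
    intro y hy hya
    obtain ⟨z, ⟨hz, htz⟩, hcz⟩ := tp1_eq_iff.1 (tp1_eq_of_mem_locus hya hc) _ (hηd.fiber a₀) hy
    exact ht z htz ⟨hz, hcz⟩
  have hη' : ∀ b ∈ locus q A, b ∉ locus q (A ∪ {a₀}) → η a₀ b := by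
    intro b hb hab
    by_contra hn
    obtain ⟨θ₁, hθ₁d, hθ₁b, hθ₁⟩ := exists_def2_of_not_mem_locus hab
    obtain ⟨χ, hχ⟩ := hθ₁d.and hηd.not
    obtain ⟨ρ, hρ, -⟩ := h.right.convex
    obtain ⟨d, hd, hdb₀⟩ := h.right.exists_lt hb₀
    refine hub ⟨a₀, ha₀, b, hb, χ, (hχ a₀ b).2 ⟨hθ₁b, hn⟩, ⟨b, (hχ a₀ b).2 ⟨hθ₁b, hn⟩, hb⟩, ρ, hρ,
      d, hd, c, hcA, ?_⟩
    rintro y ⟨hy, hyA⟩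
    obtain ⟨hy₁, hy₂⟩ := (hχ a₀ y).1 hy
    refine ⟨hρ.increasing _ _ ⟨hd, (h.right.lt_or_lt hdb₀ hyA).resolve_right fun hyb => hy₂ ?_⟩,
      hρ.increasing _ _ ⟨hyA, hgt y hyA (hθ₁ y hy₁)⟩⟩
    exact ⟨b₀, ⟨hθ₀, mem_locus_iff.1 hb₀ t htd hqt⟩, hlt _ hyA _ hyb⟩
  refine ⟨η, hηd, fun a ha b hb => ?_⟩
  obtain ⟨b', hb'⟩ := hM.exists_tp2_eq h.left.small (tp1_eq_of_mem_locus ha ha₀) b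
  have hb'A := mem_locus_of_tp1_eq (tp2_right hb') hb
  constructor
  · exact fun hab hn => hη b' (tp2_eq_iff.1 hb' η hηd hab)
      (h.right.invariant.mem_locus subset_rfl hb' hn)
  · exact fun hn => tp2_eq_iff.1 hb'.symm η hηd (hη' b' hb'A fun hn' =>
      hn (h.right.invariant.mem_locus subset_rfl hb'.symm hn'))

theorem not_boundedKind_symm (hub : ¬ BoundedKind p q A) : ¬ BoundedKind q p A :=
  fun hn => hub (h.symm.boundedKind_symm hn)

/-- If `q` is strongly regular over `A`, then the order of realizations of `p` is relatively
definable: `a` lies below `a'` iff some solution `y` of the formula `ψ` that witnesses strong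
regularity is such that `a` and not `a'` depends on `y`. Such a `y` must realize `q` over `A`,
since otherwise it would affect neither `q` nor `p`. -/
theorem exists_separating (hub : ¬ BoundedKind p q A) (hq : IsStronglyRegularOver q A) :
    ∃ r : C → C → Prop, Def2 L A r ∧ ∀ a ∈ locus p A, ∀ a' ∈ locus p A,
      ((∃ y, r y a ∧ ¬ r y a') ↔ a' ∈ locus p (A ∪ {a})) ∧
      ∀ y, r y a → ¬ r y a' →
        y ∈ locus q A ∧ a ∉ locus p (A ∪ {y}) ∧ a' ∈ locus p (A ∪ {y}) := by
  have hM := h.left.monster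
  obtain ⟨θ, hθd, hθ⟩ := h.symm.exists_def2_iff (h.not_boundedKind_symm hub)
  obtain ⟨-, ψ, hψq, hψ⟩ := hq
  -- The formula `ψ` is implicit in both conjuncts of `r y a ∧ ¬ r y a'`.
  let r : C → C → Prop := fun y x => Sat ψ ![y] ∧ θ y x
  have hψd : Def1 L A fun y => Sat ψ ![y] := ⟨ψ, fun _ => Iff.rfl⟩
  have hrd : Def2 L A r := hψd.left.and hθd
  have hrQ : ∀ a ∈ locus p A, ∀ a' ∈ locus p A, ∀ y, r y a → ¬ r y a' →
      y ∈ locus q A ∧ a ∉ locus p (A ∪ {y}) ∧ a' ∈ locus p (A ∪ {y}) := by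
    rintro a ha a' ha' y ⟨hy, hya⟩ hn
    have hya' : ¬ θ y a' := fun hn' => hn ⟨hy, hn'⟩
    rcases hψ A subset_rfl h.left.small y hy with hyQ | hyQ
    · exact ⟨hyQ, (hθ y hyQ a ha).1 hya, not_not.1 fun hn' => hya' ((hθ y hyQ a' ha').2 hn')⟩
    · have hsub := h.locus_subset_of_locus_subset subset_rfl h.left.small
        (fun d hd => h.exists_not_mem_locus' hd) hyQ
      exact absurd (tp1_eq_iff.1 (tp1_eq_of_mem_locus (hsub ha) (hsub ha')) _ (hθd.fiber y) hya)
        hya'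
  refine ⟨r, hrd, fun a ha a' ha' => ⟨⟨?_, fun haa' => ?_⟩, hrQ a ha a' ha'⟩⟩
  · rintro ⟨y, hya, hya'⟩
    obtain ⟨hy, h1, h2⟩ := hrQ a ha a' ha' y hya hya'
    exact locus_mono p (Set.union_subset_union_left _ Set.subset_union_left)
      (h.left.absorb Set.subset_union_left (h.left.small₁ y) ha h1 h2)
  · obtain ⟨b, hb, hab⟩ := h.exists_not_mem_locus' ha
    obtain ⟨a₂, ha₂⟩ := hM.locus_nonempty (h.left.small₂ a b) p
    obtain ⟨b', hb'⟩ := hM.exists_tp2_eq (h.left.small₁ a)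
      (tp1_eq_of_mem_locus (locus_mono p Set.subset_union_left ha₂) haa') b
    have hb'A := mem_locus_of_tp1_eq (tp1_mono Set.subset_union_left (tp2_right hb')) hb
    refine ⟨b', ⟨mem_locus_iff.1 hb'A _ hψd (mem_restrict_iff.1 hψq), (hθ b' hb'A a ha).2 ?_⟩,
      fun hn => (hθ b' hb'A a' ha').1 hn.2 ?_⟩
    · exact fun hn => hab (h.left.invariant.mem_locus subset_rfl
        (tp2_swap (tp2_same_left.2 (tp2_right hb'))).symm hn)
    · exact h.left.invariant.mem_locus subset_rfl
        (tp2_swap (tp2_mono Set.subset_union_left hb'))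
        (locus_mono p (Set.union_subset_union_left _ Set.subset_union_left) ha₂)

/-- The order of realizations of `p` over `A` is relatively definable. -/
theorem exists_def2_lt (hub : ¬ BoundedKind p q A) (hq : IsStronglyRegularOver q A) :
    ∃ σ : C → C → Prop, Def2 L A σ ∧
      ∀ a ∈ locus p A, ∀ a' ∈ locus p A, σ a a' ↔ a' ∈ locus p (A ∪ {a}) := by
  obtain ⟨r, hrd, hr⟩ := h.exists_separating hub hq
  exact ⟨_, hrd.swap.exists_and hrd.swap.not, fun a ha a' ha' => (hr a ha a' ha').1⟩

theorem isSimple (hub : ¬ BoundedKind p q A) (hq : IsStronglyRegularOver q A) :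
    IsSimple p A := by
  obtain ⟨σ, hσd, hσ⟩ := h.exists_def2_lt hub hq
  obtain ⟨φ, hφ⟩ := hσd.not.and hσd.swap.not
  refine ⟨φ, fun a ha b hb => ?_⟩
  refine (hφ a b).trans ?_
  simp only [hσ a ha b hb, hσ b hb a ha]
  exact ⟨fun hn => ⟨ha, hn.2, hn.1⟩, fun hn => ⟨hn.2.2, hn.2.1⟩⟩

/-- Elements of a model that realize `p` and are related by `◁` are separated by a realization
of `q` in the model. -/
theorem exists_between_mem (hub : ¬ BoundedKind p q A) (hq : IsStronglyRegularOver q A)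
    {M : L.ElementarySubstructure C} (hAM : A ⊆ (M : Set C)) {a a' : C} (ha : a ∈ locus p A)
    (ha' : a' ∈ locus p A) (haM : a ∈ M) (haM' : a' ∈ M) (haa' : a' ∈ locus p (A ∪ {a})) :
    ∃ b ∈ locus q A, b ∈ M ∧ a ∉ locus p (A ∪ {b}) ∧ a' ∈ locus p (A ∪ {b}) := by
  obtain ⟨r, hrd, hr⟩ := h.exists_separating hub hq
  obtain ⟨b, hbM, hb⟩ := (((hrd.swap.fiber a).mono Set.subset_union_left).and
    ((hrd.swap.fiber a').mono (Set.union_subset_union_left _ Set.subset_union_left)).not).exists_mem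
    (M := M) (B := A ∪ {a} ∪ {a'})
    (Set.union_subset (Set.union_subset hAM (Set.singleton_subset_iff.2 haM))
      (Set.singleton_subset_iff.2 haM')) ((hr a ha a' ha').1.2 haa')
  obtain ⟨h1, h2⟩ := (hr a ha a' ha').2 b hb.1 hb.2
  exact ⟨b, h1, hbM, h2⟩

/-- As the order of realizations of `p` is relatively definable and their set is convex, this
order is dense in every model. -/
theorem exists_between_mem_same (hub : ¬ BoundedKind p q A) (hq : IsStronglyRegularOver q A)
    {M : L.ElementarySubstructure C} (hAM : A ⊆ (M : Set C)) {a a' : C} (ha : a ∈ locus p A)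
    (ha' : a' ∈ locus p A) (haM : a ∈ M) (haM' : a' ∈ M) (haa' : a' ∈ locus p (A ∪ {a})) :
    ∃ x ∈ locus p A, x ∈ M ∧ x ∈ locus p (A ∪ {a}) ∧ a' ∈ locus p (A ∪ {x}) := by
  have hM := h.left.monster
  obtain ⟨σ, hσd, hσ⟩ := h.exists_def2_lt hub hq
  obtain ⟨lt, hltd, -, -, hlt, hconv⟩ := h.left.exists_witness
  obtain ⟨z, hz⟩ := h.left.exists_gt a
  obtain ⟨a₂, ha₂⟩ := hM.locus_nonempty (h.left.small₂ a z) p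
  obtain ⟨x, hx⟩ := hM.exists_tp2_eq (h.left.small₁ a)
    (tp1_eq_of_mem_locus (locus_mono p Set.subset_union_left ha₂) haa') z
  have hax := mem_locus_of_tp1_eq (tp2_right hx) hz
  have hxA := locus_mono p Set.subset_union_left hax
  have hxa' := h.left.invariant.mem_locus subset_rfl
    (tp2_swap (tp2_mono Set.subset_union_left hx))
    (locus_mono p (Set.union_subset_union_left _ Set.subset_union_left) ha₂)
  obtain ⟨y, hyM, ⟨hy1, hy2⟩, hy3, hy4⟩ :=
    ((((hltd.and hσd).fiber a).mono Set.subset_union_left).and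
    (((hltd.and hσd).swap.fiber a').mono
      (Set.union_subset_union_left _ Set.subset_union_left))).exists_mem
    (M := M) (B := A ∪ {a} ∪ {a'})
    (Set.union_subset (Set.union_subset hAM (Set.singleton_subset_iff.2 haM))
      (Set.singleton_subset_iff.2 haM'))
    ⟨x, ⟨hlt a ha x hax, (hσ a ha x hxA).2 hax⟩, hlt x hxA a' hxa', (hσ x hxA a' ha').2 hxa'⟩
  have hyA := hconv a ha a' ha' y hy1 hy3
  exact ⟨y, hyA, hyM, (hσ a ha y hyA).1 hy2, (hσ y hyA a' ha').1 hy4⟩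

/-- In the unbounded case no classes match. -/
theorem lt_or_lt_of_not_boundedKind (hub : ¬ BoundedKind p q A) (hnc : NeverCommute p q A)
    {a b : C} (ha : a ∈ locus p A) (hb : b ∈ locus q A) :
    a ∈ locus p (A ∪ {b}) ∨ b ∈ locus q (A ∪ {a}) := by
  by_contra! hn
  obtain ⟨θ, hθd, hθ⟩ := h.exists_def2_iff hub
  obtain ⟨η, hηd, hη⟩ := h.symm.exists_def2_iff (h.not_boundedKind_symm hub)
  obtain ⟨χ, hχ⟩ := hθd.and hηd.swap
  have hmatch : ∀ y ∈ locus q A, Sat χ ![a, y] ↔ Match p q A a y := fun y hy => by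
    refine (hχ a y).trans ?_
    simp only [hθ a ha y hy, hη y hy a ha, Match]
  have hab := (hmatch b hb).2 ⟨hn.2, hn.1⟩
  refine hub ⟨a, ha, b, hb, χ, hab, h.right.isBoundedSet_of_class hb hab fun y hy hyA => ?_⟩
  have h1 := (hmatch b hb).1 hab
  have h2 := (hmatch y hyA).1 hy
  exact ⟨fun hn => h.left.asymm ((h.lt_iff_of_match hnc ha ha hb hyA h1 h2).2 hn)
    ((h.lt_iff_of_match hnc ha ha hb hyA h1 h2).2 hn),
    fun hn => h.left.asymm ((h.lt_iff_of_match hnc ha ha hyA hb h2 h1).2 hn)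
    ((h.lt_iff_of_match hnc ha ha hyA hb h2 h1).2 hn)⟩

/-! ### Comparison of the invariants -/

theorem invariants_of_bounded (hbd : BoundedKind p q A) (M : L.ElementarySubstructure C)
    (hAM : A ⊆ (M : Set C)) :
    ∃ (I J : Type w) (_ : LinearOrder I) (_ : LinearOrder J),
      IsInv p A M I ∧ IsInv q A M J ∧
      (¬ CommuteOver p q A → Nonempty (I ≃o J)) ∧
      (CommuteOver p q A → Nonempty (I ≃o Jᵒᵈ)) := by
  obtain ⟨I, _, π, hπ, hlt⟩ := h.left.exists_inv (M : Set C)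
  obtain ⟨J, _, π', hπ', hlt'⟩ := h.right.exists_inv (M : Set C)
  refine ⟨I, J, inferInstance, inferInstance, h.left.isInv hπ hlt, h.right.isInv hπ' hlt',
    fun hcm => ?_, fun hcm => ?_⟩
  · have hnc := h.neverCommute hcm
    refine nonempty_orderIso_of_rel hπ hπ' (S := fun x y => Match p q A x y) (fun x => ?_)
      (fun y => ?_) fun x x' y y' hxy hxy' => ?_
    · obtain ⟨b, hb, hbM, hm, -⟩ := h.exists_match_mem hbd hAM x.2.1 x.2.2
      exact ⟨⟨b, hb, hbM⟩, hm hcm⟩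
    · obtain ⟨a, ha, haM, hm, -⟩ :=
        h.symm.exists_match_mem (h.boundedKind_symm hbd) hAM y.2.1 y.2.2
      exact ⟨⟨a, ha, haM⟩, (hm fun hn => hcm (hn.symm h.symm)).symm⟩
    · rw [hlt, hlt', h.lt_iff_of_match hnc x.2.1 x'.2.1 y.2.1 y'.2.1 hxy hxy']
  · have hc := h.commute hcm
    refine nonempty_orderIso_of_rel hπ (π' := fun y => OrderDual.toDual (π' y))
      (OrderDual.toDual.surjective.comp hπ') (S := fun x y => CoMatch p q A x y) (fun x => ?_)
      (fun y => ?_) fun x x' y y' hxy hxy' => ?_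
    · obtain ⟨b, hb, hbM, -, hm⟩ := h.exists_match_mem hbd hAM x.2.1 x.2.2
      exact ⟨⟨b, hb, hbM⟩, hm hcm⟩
    · obtain ⟨a, ha, haM, -, hm⟩ :=
        h.symm.exists_match_mem (h.boundedKind_symm hbd) hAM y.2.1 y.2.2
      exact ⟨⟨a, ha, haM⟩, (hm (hcm.symm h)).symm hc.symm y.2.1 ha⟩
    · rw [OrderDual.toDual_lt_toDual, hlt, hlt',
        h.lt_iff_of_coMatch hc x.2.1 x'.2.1 y.2.1 y'.2.1 hxy hxy']

theorem denselyOrdered (hub : ¬ BoundedKind p q A) (hq : IsStronglyRegularOver q A)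
    {M : L.ElementarySubstructure C} (hAM : A ⊆ (M : Set C)) {I : Type w} [LinearOrder I]
    {π : {a : C // a ∈ locus p A ∧ a ∈ (M : Set C)} → I} (hπ : Function.Surjective π)
    (hlt : ∀ x y, π x < π y ↔ (y : C) ∈ locus p (A ∪ {(x : C)})) : DenselyOrdered I := by
  refine ⟨fun i i' hii' => ?_⟩
  obtain ⟨x, rfl⟩ := hπ i
  obtain ⟨x', rfl⟩ := hπ i'
  obtain ⟨z, hz, hzM, h1, h2⟩ := h.exists_between_mem_same hub hq hAM x.2.1 x'.2.1 x.2.2 x'.2.2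
    ((hlt _ _).1 hii')
  exact ⟨π ⟨z, hz, hzM⟩, (hlt _ _).2 h1, (hlt _ _).2 h2⟩

theorem invariants_of_unbounded (hub : ¬ BoundedKind p q A) (hp : IsStronglyRegularOver p A)
    (hq : IsStronglyRegularOver q A) (M : L.ElementarySubstructure C) (hAM : A ⊆ (M : Set C)) :
    ∃ (I J : Type w) (_ : LinearOrder I) (_ : LinearOrder J),
      IsInv p A M I ∧ IsInv q A M J ∧
      (¬ CommuteOver p q A → Nonempty (DedekindCompletion I ≃o DedekindCompletion J)) ∧
      (CommuteOver p q A → Nonempty (DedekindCompletion I ≃o (DedekindCompletion J)ᵒᵈ)) := by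
  obtain ⟨I, _, π, hπ, hlt⟩ := h.left.exists_inv (M : Set C)
  obtain ⟨J, _, π', hπ', hlt'⟩ := h.right.exists_inv (M : Set C)
  have hub' := h.not_boundedKind_symm hub
  have hX : ∀ x x' : {a : C // a ∈ locus p A ∧ a ∈ (M : Set C)},
      ∀ y : {b : C // b ∈ locus q A ∧ b ∈ (M : Set C)}, π x ≤ π x' →
        (x : C) ∈ locus p (A ∪ {(y : C)}) → (x' : C) ∈ locus p (A ∪ {(y : C)}) :=
    fun x x' y hle hxy => h.left.mem_locus_of_not Set.subset_union_left (h.left.small₁ _) x'.2.1 hxy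
      fun hn => not_lt.2 hle ((hlt _ _).2 hn)
  have hIJ : ∀ x x', π x < π x' → ∃ y : {b : C // b ∈ locus q A ∧ b ∈ (M : Set C)},
      (x : C) ∉ locus p (A ∪ {(y : C)}) ∧ (x' : C) ∈ locus p (A ∪ {(y : C)}) := fun x x' hxx' => by
    obtain ⟨b, hb, hbM, hxb⟩ := h.exists_between_mem hub hq hAM x.2.1 x'.2.1 x.2.2 x'.2.2
      ((hlt _ _).1 hxx')
    exact ⟨⟨b, hb, hbM⟩, hxb⟩
  have hJI : ∀ y y', π' y < π' y' → ∃ x : {a : C // a ∈ locus p A ∧ a ∈ (M : Set C)},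
      (y : C) ∉ locus q (A ∪ {(x : C)}) ∧ (y' : C) ∈ locus q (A ∪ {(x : C)}) := fun y y' hyy' => by
    obtain ⟨a, ha, haM, hya⟩ := h.symm.exists_between_mem hub' hp hAM y.2.1 y'.2.1 y.2.2 y'.2.2
      ((hlt' _ _).1 hyy')
    exact ⟨⟨a, ha, haM⟩, hya⟩
  refine ⟨I, J, inferInstance, inferInstance, h.left.isInv hπ hlt, h.right.isInv hπ' hlt',
    fun hcm => ?_, fun hcm => ?_⟩
  · have hnc := h.neverCommute hcm
    have hY : ∀ x : {a : C // a ∈ locus p A ∧ a ∈ (M : Set C)},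
        ∀ y y' : {b : C // b ∈ locus q A ∧ b ∈ (M : Set C)}, π' y' ≤ π' y →
          (x : C) ∈ locus p (A ∪ {(y : C)}) → (x : C) ∈ locus p (A ∪ {(y' : C)}) :=
      fun x y y' hle hxy => h.lt_of_neverCommute hnc y'.2.1
        (fun hn => not_lt.2 hle ((hlt' _ _).2 hn)) hxy
    obtain ⟨r, hr⟩ := exists_rel_quotient (fun x x' y he => hX x x' y he.le)
      (fun x y y' he => hY x y y' he.ge)
    refine nonempty_dedekindCompletion_orderIso (r := r) (hπ.forall₂.2 fun x x' =>
      hπ'.forall.2 fun y => ?_) (hπ.forall.2 fun x => hπ'.forall₂.2 fun y y' => ?_)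
      (hπ.forall₂.2 fun x x' hxx' => ?_) (hπ'.forall₂.2 fun y y' hyy' => ?_)
    · rw [hr, hr]
      exact fun hxy hle => hX x x' y hle hxy
    · rw [hr, hr]
      exact fun hxy hle => hY x y y' hle hxy
    · obtain ⟨y, hy⟩ := hIJ x x' hxx'
      exact ⟨π' y, by rwa [hr, hr]⟩
    · obtain ⟨x, hx1, hx2⟩ := hJI y y' hyy'
      refine ⟨π x, (hr _ _).2 ?_, fun hn => hnc x y' hx2 ((hr _ _).1 hn)⟩
      exact (h.lt_or_lt_of_not_boundedKind hub hnc x.2.1 y.2.1).resolve_right hx1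
  · have hc := h.commute hcm
    have hY : ∀ x : {a : C // a ∈ locus p A ∧ a ∈ (M : Set C)},
        ∀ y y' : {b : C // b ∈ locus q A ∧ b ∈ (M : Set C)}, π' y ≤ π' y' →
          (x : C) ∈ locus p (A ∪ {(y : C)}) → (x : C) ∈ locus p (A ∪ {(y' : C)}) :=
      fun x y y' hle hxy => (hc x x.2.1 y' y'.2.1).1 <|
        h.right.mem_locus_of_not Set.subset_union_left (h.left.small₁ _) y'.2.1
          ((hc x x.2.1 y y.2.1).2 hxy) fun hn => not_lt.2 hle ((hlt' _ _).2 hn)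
    obtain ⟨r, hr⟩ := exists_rel_quotient (fun x x' y he => hX x x' y he.le)
      (fun x y y' he => hY x y y' he.le)
    have := h.denselyOrdered hub hq hAM hπ hlt
    have := h.symm.denselyOrdered hub' hp hAM hπ' hlt'
    refine nonempty_dedekindCompletion_orderIso_dual (r := r) (hπ.forall₂.2 fun x x' =>
      hπ'.forall.2 fun y => ?_) (hπ.forall.2 fun x => hπ'.forall₂.2 fun y y' => ?_)
      (hπ.forall₂.2 fun x x' hxx' => ?_) (hπ'.forall₂.2 fun y y' hyy' => ?_)
    · rw [hr, hr]
      exact fun hxy hle => hX x x' y hle hxy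
    · rw [hr, hr]
      exact fun hxy hle => hY x y y' hle hxy
    · obtain ⟨y, hy⟩ := hIJ x x' hxx'
      exact ⟨π' y, by rwa [hr, hr]⟩
    · obtain ⟨x, hx1, hx2⟩ := hJI y y' hyy'
      refine ⟨π x, fun hn => hx1 ((hc x x.2.1 y y.2.1).2 ((hr _ _).1 hn)),
        (hr _ _).2 ((hc x x.2.1 y' y'.2.1).1 hx2)⟩

end NonorthPair

end Unbounded

end RegularTypes

theorem mainTheorem2 {L : FirstOrder.Language.{u, v}} {C : Type w} [L.Structure C] (hC : IsMonster L C)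
    (A : Set C) (hA : IsSmall A) (p q : GlobalType L C)
    (hp : IsRegularOver p A) (hpa : IsAsymmetric p A) (hpc : IsConvex p A)
    (hq : IsRegularOver q A) (hqa : IsAsymmetric q A) (hqc : IsConvex q A)
    (hpq : ¬ WeaklyOrthogonal (restrict p A) (restrict q A)) :
    (BoundedKind p q A →
      ∀ M : L.ElementarySubstructure C, IsSmall (M : Set C) → A ⊆ (M : Set C) →
        ∃ (I J : Type w) (_ : LinearOrder I) (_ : LinearOrder J),
          IsInv p A M I ∧ IsInv q A M J ∧
          (¬ CommuteOver p q A → Nonempty (I ≃o J)) ∧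
          (CommuteOver p q A → Nonempty (I ≃o Jᵒᵈ))) ∧
    (¬ BoundedKind p q A → IsStronglyRegularOver p A → IsStronglyRegularOver q A →
      IsSimple p A ∧ IsSimple q A ∧
      ∀ M : L.ElementarySubstructure C, IsSmall (M : Set C) → A ⊆ (M : Set C) →
        ∃ (I J : Type w) (_ : LinearOrder I) (_ : LinearOrder J),
          IsInv p A M I ∧ IsInv q A M J ∧
          (¬ CommuteOver p q A →
            Nonempty (DedekindCompletion I ≃o DedekindCompletion J)) ∧
          (CommuteOver p q A →
            Nonempty (DedekindCompletion I ≃o (DedekindCompletion J)ᵒᵈ))) := by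
  have h : NonorthPair p q A := ⟨⟨hC, hA, hp, hpc⟩, ⟨hC, hA, hq, hqc⟩, hpq⟩
  refine ⟨fun hbd M _ hAM => h.invariants_of_bounded hbd M hAM, fun hub hps hqs => ?_⟩
  have hub' := h.not_boundedKind_symm hub
  exact ⟨h.isSimple hub hqs, h.symm.isSimple hub' hps,
    fun M _ hAM => h.invariants_of_unbounded hub hps hqs M hAM⟩
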